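/- Let $\eta$ be a random variable with values in $\{0,1,2,\dots\}$ and let $d\ge 2$. Consider the frog model on the nearest-neighbour graph $\mathbb Z^d$ with survival parameter $p\in[0,1]$: the initial numbers of particles $\eta(x)$, $x\in\mathbb Z^d$, are i.i.d. copies of $\eta$; the $i$-th particle from $x$ ($1\le i\le\eta(x)$) has a simple random walk $(S^x_n(i))_{n\ge0}$ on $\mathbb Z^d$ started at $x$ and a lifetime $\Xi^x_p(i)$ with $\mathbf P[\Xi^x_p(i)=k]=(1-p)p^{k-1}$, $k=1,2,\dots$ (and $\Xi^x_p(i)=\infty$ if $p=1$), all these variables being independent. Let $t(x,y)=\min_{1\le i\le\eta(x)}\min\{n<\Xi^x_p(i): S^x_n(i)=y\}$ (with $\min\emptyset=\infty$), and let the activation time of $x$ be $T(x)=\inf\{t(x_0,x_1)+\dots+t(x_{m-1},x_m)\}$, the infimum being over all finite sequences $0=x_0,x_1,\dots,x_m=x$, $m\ge0$, so that $T(0)=0$. The $i$-th particle from $x$ is active at time $n$ if $T(x)\le n<T(x)+\Xi^x_p(i)$, and the model survives if at every time $n=0,1,2,\dots$ at least one particle is active. Let $$p_c(\mathbb Z^d,\eta)=\inf\{p\in[0,1]:\mathbf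 P[\text{the model with parameter } p \text{ survives}]>0\}$$ (with $\inf\emptyset=1$). If $\mathbf P[\eta\ge1]>0$, then $p_c(\mathbb Z^d,\eta)<1$; moreover there is $p_0<1$ such that the model survives with positive probability for every $p\in(p_0,1]$. -/

import Mathlib

namespace FrogModel

open MeasureTheory ProbabilityTheory

noncomputable section

/-- The vertices of the lattice `ℤ^d`. -/
abbrev Site (d : ℕ) : Type := Fin d → ℤ

/-- The neighbours of the origin in the nearest-neighbour graph on `ℤ^d`. -/
def unitSteps (d : ℕ) : Set (Site d) := {e | ∑ j, |e j| = 1}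

/-- The law of one step of simple random walk on `ℤ^d`: uniform on the `2d` neighbours of `0`. -/
def stepLaw (d : ℕ) : Measure (Site d) := uniformOn (unitSteps d)

/-- The law of a lifetime `Ξ` with survival parameter `p`: for `p < 1`,
`P[Ξ = k + 1] = (1 - p) p ^ k` for `k = 0, 1, 2, …`; for `p = 1` there is no death, `Ξ = ∞`. -/
def lifetimeLaw (p : unitInterval) : Measure ℕ∞ :=
  if p < 1 then
    Measure.sum fun k : ℕ =>
      ENNReal.ofReal ((1 - (p : ℝ)) * (p : ℝ) ^ k) • Measure.dirac ((k + 1 : ℕ) : ℕ∞)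
  else Measure.dirac ⊤

/-- A realization of all the randomness. The particles with original position `x` are
`(x, 0), …, (x, count x - 1)`; the variables of the other pairs `(x, i)` are not used. -/
abbrev Config (d : ℕ) : Type :=
  (Site d → ℕ) × (Site d × ℕ × ℕ → Site d) × (Site d × ℕ → ℕ∞)

/-- The initial number of particles at `x`. -/
def count {d : ℕ} (ω : Config d) (x : Site d) : ℕ := ω.1 x

/-- The position after `n` steps of the walk of the `i`-th particle from `x`. -/
def walk {d : ℕ} (ω : Config d) (x : Site d) (i n : ℕ) : Site d :=
  x + ∑ k ∈ Finset.range n, ω.2.1 (x, i, k)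

/-- The lifetime, counted from its activation, of the `i`-th particle from `x`. -/
def lifetime {d : ℕ} (ω : Config d) (x : Site d) (i : ℕ) : ℕ∞ := ω.2.2 (x, i)

/-- The law of the frog model on `ℤ^d` with survival parameter `p`, when the initial number of
particles at a site has law `ν`: all the variables are independent. -/
def law (d : ℕ) (ν : Measure ℕ) (p : unitInterval) : Measure (Config d) :=
  (Measure.infinitePi fun _ : Site d => ν).prod
    ((Measure.infinitePi fun _ : Site d × ℕ × ℕ => stepLaw d).prod
      (Measure.infinitePi fun _ : Site d × ℕ => lifetimeLaw p))

/-- The time that the particles from `x` need, once activated, to visit `y`; it is `⊤` if none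
of them does before it dies. -/
def hitTime {d : ℕ} (ω : Config d) (x y : Site d) : ℕ∞ :=
  ⨅ (i : ℕ) (n : ℕ) (_ : i < count ω x ∧ (n : ℕ∞) < lifetime ω x i ∧ walk ω x i n = y), (n : ℕ∞)

/-- The time at which the particles at `x` are activated: the infimum of
`t(x₀,x₁) + ⋯ + t(x_{m-1},x_m)` over the finite sequences `0 = x₀, …, x_m = x`, `m ≥ 0`. -/
def activationTime {d : ℕ} (ω : Config d) (x : Site d) : ℕ∞ :=
  ⨅ (m : ℕ) (z : Fin (m + 1) → Site d) (_ : z 0 = 0 ∧ z (Fin.last m) = x),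
    ∑ j : Fin m, hitTime ω (z j.castSucc) (z j.succ)

/-- The `i`-th particle from `x` exists and is active at time `n`. -/
def IsActive {d : ℕ} (ω : Config d) (x : Site d) (i n : ℕ) : Prop :=
  i < count ω x ∧ activationTime ω x ≤ n ∧ (n : ℕ∞) < activationTime ω x + lifetime ω x i

/-- The realization survives: at every time there is an active particle. -/
def Survives {d : ℕ} (ω : Config d) : Prop := ∀ n : ℕ, ∃ x i, IsActive ω x i n

/-- The probability that the frog model on `ℤ^d` survives. -/
def survivalProb (d : ℕ) (ν : Measure ℕ) (p : unitInterval) : ENNReal :=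
  law d ν p {ω | Survives ω}

/-- The critical parameter: the infimum, within `[0, 1]`, of the parameters for which survival has
positive probability. The infimum of the empty set is `1`. -/
def criticalParam (d : ℕ) (ν : Measure ℕ) : unitInterval :=
  sInf {p : unitInterval | 0 < survivalProb d ν p}

theorem finite_unitSteps (d : ℕ) : (unitSteps d).Finite := by
  refine (Set.finite_Icc (fun _ : Fin d => (-1 : ℤ)) (fun _ => 1)).subset fun e he => ?_
  have h : ∀ j, |e j| ≤ 1 := fun j =>
    (Finset.single_le_sum (fun i _ => abs_nonneg (e i)) (Finset.mem_univ j)).trans_eq he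
  exact ⟨fun j => (abs_le.1 (h j)).1, fun j => (abs_le.1 (h j)).2⟩

theorem nonempty_unitSteps {d : ℕ} (hd : 0 < d) : (unitSteps d).Nonempty := by
  refine ⟨Pi.single ⟨0, hd⟩ 1, ?_⟩
  show ∑ j, |(Pi.single (⟨0, hd⟩ : Fin d) (1 : ℤ) : Site d) j| = 1
  rw [Finset.sum_eq_single (⟨0, hd⟩ : Fin d)] <;> simp +contextual

theorem isProbabilityMeasure_stepLaw {d : ℕ} (hd : 0 < d) :
    IsProbabilityMeasure (stepLaw d) :=
  isProbabilityMeasure_uniformOn (finite_unitSteps d) (nonempty_unitSteps hd)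

instance isProbabilityMeasure_lifetimeLaw (p : unitInterval) :
    IsProbabilityMeasure (lifetimeLaw p) := by
  unfold lifetimeLaw
  split_ifs with h
  · have hp : (p : ℝ) < 1 := h
    have hs := (hasSum_geometric_of_lt_one p.2.1 hp).mul_left (1 - (p : ℝ))
    rw [mul_inv_cancel₀ (by linarith)] at hs
    refine ⟨?_⟩
    rw [Measure.sum_apply _ MeasurableSet.univ]
    simp only [Measure.smul_apply, measure_univ, smul_eq_mul, mul_one]
    rw [← ENNReal.ofReal_tsum_of_nonneg
      (fun k => mul_nonneg (by linarith) (pow_nonneg p.2.1 k)) hs.summable, hs.tsum_eq,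
      ENNReal.ofReal_one]
  · infer_instance

end

end FrogModel

/-! The proof is a Peierls argument on coarse-grained blocks. Use only the first particle of each
site and only its first `N` steps, and ask that it live longer than `N`. The reduced variables
`frogs` are i.i.d. over the sites. If the cluster of sites reached from the origin through them is
infinite, the model survives (`survives_of_infinite_cluster`): only finitely many sites can be
reached by any given time.

Project `ℤ^d` to two coordinates and cut the plane into blocks of side `r`. A walk started near a
block enters an adjacent block with probability at least `hitConst`, whatever `r` is, once `N` is
large (`exists_hitConst_le_block`); the projected walk is two-dimensional, and a strictly
subharmonic Gaussian profile gives the bound. For `p` close to one, depending on `N`, each site thus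
succeeds with probability at least some `α > 0` that does not depend on `r`.

Suppose that the cluster is finite and that the particle of the origin has gone straight for `3 r`
steps. The blocks met form a finite connected planar set. For some `k` its boundary contains a chain
of `k + 1` distinct edges that starts at distance `k` on the positive axis
(`exists_edgeChain_boundary`). Near each such edge the cluster has at least `r` sites besides the
origin (`le_card_nearBlock`), all of which fail to enter the block across the edge. A site is near
at most 36 edges, so `r = 36 L` gives at least `(k + 1) L` failing sites. By `infinitePi_cluster_le`
these failures cost `(1 - α) ^ (L (k + 1))`, with no entropy for the shape of the cluster, and there
are at most `36 ^ k` chains. For `L` large the sum over `k` is at most a third of the probability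
`g` of the straight start, so the cluster is infinite with positive probability. -/

namespace FrogModel

open MeasureTheory ProbabilityTheory

noncomputable section

/-! ### Planar topology: the boundary of a finite connected set. -/

/-- The four nearest-neighbour directions of the planar lattice. -/
def planarSteps : Finset (ℤ × ℤ) := {(1, 0), (-1, 0), (0, 1), (0, -1)}

theorem mem_planarSteps {u : ℤ × ℤ} :
    u ∈ planarSteps ↔ u = (1, 0) ∨ u = (-1, 0) ∨ u = (0, 1) ∨ u = (0, -1) := by
  simp [planarSteps]

/-- `(u, v)` is an edge of the planar lattice that leaves `D`. -/
def IsBoundaryEdge (D : Set (ℤ × ℤ)) (e : (ℤ × ℤ) × (ℤ × ℤ)) : Prop :=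
  e.1 ∈ D ∧ e.2 ∉ D ∧ e.2 - e.1 ∈ planarSteps

/-- The unit square with lower left corner `s` contains `u`. -/
def InSquare (s u : ℤ × ℤ) : Prop :=
  (u.1 = s.1 ∨ u.1 = s.1 + 1) ∧ (u.2 = s.2 ∨ u.2 = s.2 + 1)

/-- Distinct boundary edges of `D` are adjacent if they lie on a common unit square. -/
def boundaryGraph (D : Set (ℤ × ℤ)) : SimpleGraph ((ℤ × ℤ) × (ℤ × ℤ)) where
  Adj e f := e ≠ f ∧ IsBoundaryEdge D e ∧ IsBoundaryEdge D f ∧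
    ∃ s, InSquare s e.1 ∧ InSquare s e.2 ∧ InSquare s f.1 ∧ InSquare s f.2
  symm := ⟨fun _ _ ⟨h, he, hf, s, h1, h2, h3, h4⟩ => ⟨h.symm, hf, he, s, h3, h4, h1, h2⟩⟩
  loopless := ⟨fun _ h => h.1 rfl⟩

/-- A closed one-form on the planar lattice which vanishes outside a finite box is the
differential of a function that vanishes outside the box. -/
theorem exists_potential (H V : ℤ → ℤ → ℤ) (M : ℤ)
    (hclosed : ∀ x y, H x y + V (x + 1) y = H x (y + 1) + V x y)
    (hHr : ∀ x y, M ≤ x → H x y = 0) (hHt : ∀ x y, M ≤ y → H x y = 0)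
    (hVr : ∀ x y, M ≤ x → V x y = 0) (hVl : ∀ x y, x ≤ -M → V x y = 0) :
    ∃ g : ℤ → ℤ → ℤ, (∀ x y, g x y - g (x + 1) y = H x y) ∧
      (∀ x y, g x y - g x (y + 1) = V x y) ∧ (∀ x y, M ≤ x → g x y = 0) ∧
      (∀ x y, x ≤ -M → g x y = 0) := by
  have hg0 : ∀ x y, M ≤ x → ∑ j ∈ Finset.Ico x M, H j y = 0 := fun x y h => by
    rw [Finset.Ico_eq_empty (by omega), Finset.sum_empty]
  have hH : ∀ x y, ∑ j ∈ Finset.Ico x M, H j y - ∑ j ∈ Finset.Ico (x + 1) M, H j y = H x y := by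
    intro x y
    rcases lt_or_ge x M with h | h
    · rw [← Finset.insert_Ico_add_one_left_eq_Ico h, Finset.sum_insert (by simp)]; ring
    · rw [hg0 x y h, hg0 (x + 1) y (by omega), hHr x y h]; ring
  have hV : ∀ x y, ∑ j ∈ Finset.Ico x M, H j y - ∑ j ∈ Finset.Ico x M, H j (y + 1) = V x y := by
    intro x y
    rcases le_total M x with h | h
    · rw [hg0 x y h, hg0 x _ h, hVr x y h]; ring
    · induction x, h using Int.leInductionDown with
      | base => rw [hg0 _ _ le_rfl, hg0 _ _ le_rfl, hVr _ _ le_rfl]; ring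
      | pred n hn ih =>
        have h1 := hH (n - 1) y
        have h2 := hH (n - 1) (y + 1)
        have h3 := hclosed (n - 1) y
        rw [sub_add_cancel] at h1 h2 h3
        linarith
  refine ⟨fun x y => ∑ j ∈ Finset.Ico x M, H j y, hH, hV, hg0, fun x y hx => ?_⟩
  -- On the left side `V` vanishes, so the sum is constant along vertical lines and equals its value
  -- above the box, which is zero.
  have htop : ∀ y, M ≤ y → ∑ j ∈ Finset.Ico x M, H j y = 0 := fun y hy =>
    Finset.sum_eq_zero fun j _ => hHt j y hy
  show ∑ j ∈ Finset.Ico x M, H j y = 0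
  rcases le_total M y with h | h
  · exact htop y h
  · induction y, h using Int.leInductionDown with
    | base => exact htop _ le_rfl
    | pred n hn ih =>
      have h1 := hV x (n - 1)
      rw [sub_add_cancel, hVl x _ hx] at h1
      linarith

/-- The boundary edge at which the positive horizontal axis leaves a finite connected set for the
last time is joined, within the boundary, to an edge of the negative horizontal axis. -/
theorem exists_reachable_boundaryEdge {D : Set (ℤ × ℤ)} (hfin : D.Finite) (h0 : (0, 0) ∈ D)
    (hconn : ∀ u ∈ D, Relation.ReflTransGen
      (fun u v => u ∈ D ∧ v ∈ D ∧ v - u ∈ planarSteps) (0, 0) u) :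
    ∃ k : ℕ, ∃ f, IsBoundaryEdge D (((k : ℤ), 0), ((k : ℤ) + 1, 0)) ∧ f.1.1 ≤ 0 ∧
      (boundaryGraph D).Reachable (((k : ℤ), 0), ((k : ℤ) + 1, 0)) f := by
  classical
  obtain ⟨M, hM⟩ : ∃ M : ℤ, ∀ u ∈ D, -M < u.1 ∧ u.1 < M ∧ u.2 < M := by
    obtain ⟨a, ha⟩ := (hfin.image fun u => |u.1| + |u.2|).bddAbove
    refine ⟨a + 1, fun u hu => ?_⟩
    have h1 := ha (Set.mem_image_of_mem _ hu)
    have h2 := abs_le.1 (le_refl |u.1|)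
    have h3 := abs_le.1 (le_refl |u.2|)
    omega
  obtain ⟨k, hk, hkmax⟩ : ∃ k : ℕ, ((k : ℤ), (0 : ℤ)) ∈ D ∧ ∀ j : ℤ, k < j → (j, (0 : ℤ)) ∉ D := by
    have hf : {j : ℕ | ((j : ℤ), (0 : ℤ)) ∈ D}.Finite :=
      hfin.preimage (f := fun j : ℕ => ((j : ℤ), (0 : ℤ))) (fun a _ b _ h => by simpa using h)
    obtain ⟨k, hk⟩ := hf.exists_maximal ⟨0, by simpa using h0⟩
    refine ⟨k, hk.1, fun j hj hjD => ?_⟩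
    lift j to ℕ using by omega
    have := hk.2 (y := j) hjD (by omega)
    omega
  set e₀ : (ℤ × ℤ) × (ℤ × ℤ) := (((k : ℤ), 0), ((k : ℤ) + 1, 0)) with he₀
  have hb₀ : IsBoundaryEdge D e₀ := ⟨hk, hkmax _ (by omega), by simp [he₀, planarSteps]⟩
  -- `K` is the boundary component of `e₀`. A unit square that contains one edge of `K` has all its
  -- boundary edges in `K`.
  set K : Set ((ℤ × ℤ) × (ℤ × ℤ)) :=
    {e | IsBoundaryEdge D e ∧ (boundaryGraph D).Reachable e₀ e} with hK
  have hKsq : ∀ s e f, e ∈ K → IsBoundaryEdge D f → InSquare s e.1 → InSquare s e.2 →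
      InSquare s f.1 → InSquare s f.2 → f ∈ K := by
    intro s e f he hf h1 h2 h3 h4
    refine ⟨hf, ?_⟩
    by_cases hef : e = f
    · exact hef ▸ he.2
    · exact he.2.trans (SimpleGraph.Adj.reachable ⟨hef, he.1, hf, s, h1, h2, h3, h4⟩)
  -- `F` is the flow out of `D` through `K`. On each unit square it is either zero or the
  -- differential of the indicator `χ` of `D`, hence it is a closed form.
  let F : ℤ × ℤ → ℤ × ℤ → ℤ := fun u v => (if (u, v) ∈ K then 1 else 0) - if (v, u) ∈ K then 1 else 0
  let χ : ℤ × ℤ → ℤ := fun u => if u ∈ D then 1 else 0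
  have hF0 : ∀ u v, (u ∈ D ↔ v ∈ D) → F u v = 0 := by
    intro u v h
    have h1 : (u, v) ∉ K := fun hh => hh.1.2.1 (h.1 hh.1.1)
    have h2 : (v, u) ∉ K := fun hh => hh.1.2.1 (h.2 hh.1.1)
    simp [F, h1, h2]
  have hFin : ∀ s e, e ∈ K → InSquare s e.1 → InSquare s e.2 → ∀ u v, InSquare s u →
      InSquare s v → v - u ∈ planarSteps → F u v = χ u - χ v := by
    intro s e he h1 h2 u v hu hv huv
    have hvu : u - v ∈ planarSteps := by
      rw [mem_planarSteps] at huv ⊢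
      simp only [Prod.ext_iff, Prod.fst_sub, Prod.snd_sub] at huv ⊢
      omega
    by_cases hu' : u ∈ D <;> by_cases hv' : v ∈ D
    · rw [hF0 u v (by tauto)]; simp [χ, hu', hv']
    · have h3 : (u, v) ∈ K := hKsq s e _ he ⟨hu', hv', huv⟩ h1 h2 hu hv
      have h4 : (v, u) ∉ K := fun hh => hv' hh.1.1
      simp [F, χ, h3, h4, hu', hv']
    · have h3 : (v, u) ∈ K := hKsq s e _ he ⟨hv', hu', hvu⟩ h1 h2 hv hu
      have h4 : (u, v) ∉ K := fun hh => hu' hh.1.1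
      simp [F, χ, h3, h4, hu', hv']
    · rw [hF0 u v (by tauto)]; simp [χ, hu', hv']
  have hFout : ∀ s, (∀ e ∈ K, InSquare s e.1 → ¬ InSquare s e.2) → ∀ u v, InSquare s u →
      InSquare s v → F u v = 0 := by
    intro s hs u v hu hv
    have h1 : (u, v) ∉ K := fun hh => hs _ hh hu hv
    have h2 : (v, u) ∉ K := fun hh => hs _ hh hv hu
    simp [F, h1, h2]
  obtain ⟨g, hgH, hgV, hgr, hgl⟩ := exists_potential (fun x y => F (x, y) (x + 1, y))
    (fun x y => F (x, y) (x, y + 1)) M (by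
      intro x y
      have q1 : InSquare (x, y) (x, y) := by simp [InSquare]
      have q2 : InSquare (x, y) (x + 1, y) := by simp [InSquare]
      have q3 : InSquare (x, y) (x, y + 1) := by simp [InSquare]
      have q4 : InSquare (x, y) (x + 1, y + 1) := by simp [InSquare]
      by_cases hs : ∃ e ∈ K, InSquare (x, y) e.1 ∧ InSquare (x, y) e.2
      · obtain ⟨e, he, h1, h2⟩ := hs
        have := hFin _ e he h1 h2
        rw [this _ _ q1 q2 (by simp [planarSteps]), this _ _ q2 q4 (by simp [planarSteps]),
          this _ _ q3 q4 (by simp [planarSteps]), this _ _ q1 q3 (by simp [planarSteps])]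
        ring
      · have hs' := hFout (x, y) (fun e he h1 h2 => hs ⟨e, he, h1, h2⟩)
        rw [hs' _ _ q1 q2, hs' _ _ q2 q4, hs' _ _ q3 q4, hs' _ _ q1 q3])
    (fun x y hx => hF0 _ _ (iff_of_false (fun h => by have := hM _ h; simp only at this; omega)
      (fun h => by have := hM _ h; simp only at this; omega)))
    (fun x y hx => hF0 _ _ (iff_of_false (fun h => by have := hM _ h; simp only at this; omega)
      (fun h => by have := hM _ h; simp only at this; omega)))
    (fun x y hx => hF0 _ _ (iff_of_false (fun h => by have := hM _ h; simp only at this; omega)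
      (fun h => by have := hM _ h; simp only at this; omega)))
    (fun x y hx => hF0 _ _ (iff_of_false (fun h => by have := hM _ h; simp only at this; omega)
      (fun h => by have := hM _ h; simp only at this; omega)))
  have hgright : ∀ x : ℤ, k < x → g x 0 = 0 := by
    intro x hx
    rcases le_total M x with h | h
    · exact hgr x 0 h
    · induction x, h using Int.leInductionDown with
      | base => exact hgr M 0 le_rfl
      | pred n hn ih =>
        have h1 := hgH (n - 1) 0
        rw [hF0 _ _ (iff_of_false (hkmax _ hx) (hkmax _ (by omega))), sub_add_cancel,
          ih (by omega)] at h1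
        linarith
  -- Beyond `k` the axis misses `D`, so the potential vanishes there and jumps to one across `e₀`.
  -- Being constant on the connected set `D`, it equals one at the origin.
  have hgk : g k 0 = 1 := by
    have h1 := hgH k 0
    have h2 : (((k : ℤ), (0 : ℤ)), ((k : ℤ) + 1, (0 : ℤ))) ∈ K := ⟨hb₀, SimpleGraph.Reachable.refl _⟩
    have h3 : (((k : ℤ) + 1, (0 : ℤ)), ((k : ℤ), (0 : ℤ))) ∉ K := fun hh => hb₀.2.1 hh.1.1
    simp only [F, if_pos h2, if_neg h3] at h1
    rw [hgright (k + 1) (by omega)] at h1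
    linarith
  have hstep : ∀ u v, u ∈ D → v ∈ D → v - u ∈ planarSteps → g u.1 u.2 = g v.1 v.2 := by
    rintro ⟨a, b⟩ ⟨a', b'⟩ hu hv h
    rw [mem_planarSteps] at h
    simp only [Prod.mk_sub_mk, Prod.mk.injEq] at h
    rcases h with h | h | h | h
    · obtain ⟨rfl, rfl⟩ : a' = a + 1 ∧ b' = b := by omega
      have := hgH a b'
      rw [hF0 _ _ (iff_of_true hu hv)] at this
      simp only; linarith
    · obtain ⟨rfl, rfl⟩ : a = a' + 1 ∧ b' = b := by omega
      have := hgH a' b'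
      rw [hF0 _ _ (iff_of_true hv hu)] at this
      simp only; linarith
    · obtain ⟨rfl, rfl⟩ : a' = a ∧ b' = b + 1 := by omega
      have := hgV a' b
      rw [hF0 _ _ (iff_of_true hu hv)] at this
      simp only; linarith
    · obtain ⟨rfl, rfl⟩ : a' = a ∧ b = b' + 1 := by omega
      have := hgV a' b'
      rw [hF0 _ _ (iff_of_true hv hu)] at this
      simp only; linarith
  have hg0 : g 0 0 = 1 := by
    have : ∀ u, Relation.ReflTransGen (fun u v => u ∈ D ∧ v ∈ D ∧ v - u ∈ planarSteps) (0, 0) u →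
        g 0 0 = g u.1 u.2 := by
      intro u hu
      induction hu with
      | refl => rfl
      | tail _ h ih => rw [ih]; exact hstep _ _ h.1 h.2.1 h.2.2
    rw [this _ (hconn _ hk), hgk]
  -- The potential must return from one to zero along the negative axis, and it can change only
  -- across an edge of `K`.
  have hneg : ∃ j : ℤ, j < 0 ∧ F (j, 0) (j + 1, 0) ≠ 0 := by
    by_contra! hcon
    have : ∀ j : ℤ, j ≤ 0 → g j 0 = 1 := by
      intro j hj
      induction j, hj using Int.leInductionDown with
      | base => exact hg0
      | pred n hn ih =>
        have h1 := hgH (n - 1) 0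
        rw [hcon _ (by omega), sub_add_cancel, ih] at h1
        linarith
    have hM0 := hM _ h0
    simp only at hM0
    have h1 := this (-M) (by omega)
    rw [hgl _ _ le_rfl] at h1
    omega
  obtain ⟨j, hj, hFj⟩ := hneg
  by_cases h1 : (((j : ℤ), (0 : ℤ)), (j + 1, (0 : ℤ))) ∈ K
  · exact ⟨k, _, hb₀, by simp only; omega, h1.2⟩
  · by_cases h2 : ((j + 1, (0 : ℤ)), (j, (0 : ℤ))) ∈ K
    · exact ⟨k, _, hb₀, by simp only; omega, h2.2⟩
    · simp [F, h1, h2] at hFj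

/-! ### Counting chains of boundary edges. -/

/-- The oriented edges of the planar lattice whose first endpoint is within sup-distance one
of `b`. -/
def edgesNear (b : ℤ × ℤ) : Finset ((ℤ × ℤ) × (ℤ × ℤ)) :=
  ((Finset.Icc (-1 : ℤ) 1 ×ˢ Finset.Icc (-1 : ℤ) 1) ×ˢ planarSteps).image
    fun q => (b + q.1, b + q.1 + q.2)

theorem card_edgesNear_le (b : ℤ × ℤ) : (edgesNear b).card ≤ 36 :=
  Finset.card_image_le.trans (by
    rw [Finset.card_product, Finset.card_product, Int.card_Icc]
    rfl)

theorem mem_edgesNear {b : ℤ × ℤ} {e : (ℤ × ℤ) × (ℤ × ℤ)} (h1 : |e.1.1 - b.1| ≤ 1)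
    (h2 : |e.1.2 - b.2| ≤ 1) (h : e.2 - e.1 ∈ planarSteps) : e ∈ edgesNear b := by
  refine Finset.mem_image.2 ⟨(e.1 - b, e.2 - e.1), ?_, by ext <;> simp⟩
  rw [abs_le] at h1 h2
  simp only [Finset.mem_product, Finset.mem_Icc, Prod.fst_sub, Prod.snd_sub]
  exact ⟨⟨h1, h2⟩, h⟩

/-- The lists of `n + 1` edges that start at `e` and in which consecutive edges are near each
other. -/
def edgeChains : ℕ → (ℤ × ℤ) × (ℤ × ℤ) → Finset (List ((ℤ × ℤ) × (ℤ × ℤ)))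
  | 0, e => {[e]}
  | n + 1, e => (edgesNear e.1).biUnion fun f => (edgeChains n f).image (List.cons e)

theorem card_edgeChains_le (n : ℕ) (e : (ℤ × ℤ) × (ℤ × ℤ)) : (edgeChains n e).card ≤ 36 ^ n := by
  induction n generalizing e with
  | zero => simp [edgeChains]
  | succ n ih =>
    calc (edgeChains (n + 1) e).card
        ≤ ∑ f ∈ edgesNear e.1, ((edgeChains n f).image (List.cons e)).card :=
          Finset.card_biUnion_le
      _ ≤ ∑ f ∈ edgesNear e.1, 36 ^ n :=
          Finset.sum_le_sum fun f _ => Finset.card_image_le.trans (ih f)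
      _ ≤ 36 ^ (n + 1) := by
          rw [Finset.sum_const, smul_eq_mul, pow_succ']
          exact Nat.mul_le_mul_right _ (card_edgesNear_le _)

theorem mem_edgesNear_of_adj {D : Set (ℤ × ℤ)} {e f : (ℤ × ℤ) × (ℤ × ℤ)}
    (h : (boundaryGraph D).Adj e f) : f ∈ edgesNear e.1 := by
  obtain ⟨-, -, hf, s, h1, -, h3, -⟩ := h
  simp only [InSquare] at h1 h3
  exact mem_edgesNear (by rw [abs_le]; omega) (by rw [abs_le]; omega) hf.2.2

theorem mem_edgeChains {D : Set (ℤ × ℤ)} (l : List ((ℤ × ℤ) × (ℤ × ℤ))) :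
    ∀ e, List.IsChain (boundaryGraph D).Adj (e :: l) → e :: l ∈ edgeChains l.length e := by
  induction l with
  | nil => simp [edgeChains]
  | cons f l ih =>
    intro e h
    rw [List.isChain_cons_cons] at h
    rw [List.length_cons, edgeChains, Finset.mem_biUnion]
    refine ⟨f, mem_edgesNear_of_adj h.1, ?_⟩
    rw [Finset.mem_image]
    exact ⟨f :: l, ih f h.2, rfl⟩

/-- A finite connected set containing the origin has a chain of `k + 1` distinct boundary
edges that starts at distance `k` on the positive horizontal axis, for some `k`. -/
theorem exists_edgeChain_boundary {D : Set (ℤ × ℤ)} (hfin : D.Finite) (h0 : (0, 0) ∈ D)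
    (hconn : ∀ u ∈ D, Relation.ReflTransGen
      (fun u v => u ∈ D ∧ v ∈ D ∧ v - u ∈ planarSteps) (0, 0) u) :
    ∃ k : ℕ, ∃ l ∈ edgeChains k (((k : ℤ), 0), ((k : ℤ) + 1, 0)),
      l.length = k + 1 ∧ l.Nodup ∧ ∀ e ∈ l, IsBoundaryEdge D e := by
  classical
  obtain ⟨k, f, hb, hf, hr⟩ := exists_reachable_boundaryEdge hfin h0 hconn
  set e₀ : (ℤ × ℤ) × (ℤ × ℤ) := (((k : ℤ), 0), ((k : ℤ) + 1, 0)) with he₀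
  obtain ⟨p, hp⟩ := hr.exists_isPath
  -- Adjacent edges share a unit square, so their first abscissas differ by at most one. A path from
  -- abscissa `k` to a nonpositive one therefore has at least `k` steps.
  have hlen : ∀ {e f} (p : (boundaryGraph D).Walk e f), e.1.1 - f.1.1 ≤ p.length := by
    intro e f p
    induction p with
    | nil => simp
    | cons h p ih =>
      obtain ⟨s, h1, -, h3, -⟩ := h.2.2.2
      simp only [InSquare] at h1 h3
      rw [SimpleGraph.Walk.length_cons]
      push_cast
      omega
  have hk : k ≤ p.length := by
    have := hlen p
    have h1 : e₀.1.1 = k := rfl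
    omega
  have hmem : ∀ {e f} (p : (boundaryGraph D).Walk e f), IsBoundaryEdge D e →
      ∀ a ∈ p.support, IsBoundaryEdge D a := by
    intro e f p
    induction p with
    | nil => intro he a ha; simp at ha; exact ha ▸ he
    | cons h p ih =>
      intro he a ha
      rw [SimpleGraph.Walk.support_cons, List.mem_cons] at ha
      rcases ha with rfl | ha
      · exact he
      · exact ih h.2.2.1 a ha
  have hlen' : (p.support.take (k + 1)).length = k + 1 := by
    rw [List.length_take, SimpleGraph.Walk.length_support]; omega
  refine ⟨k, p.support.take (k + 1), ?_, hlen', hp.support_nodup.sublist (List.take_sublist _ _),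
    fun e he => hmem p hb e (List.mem_of_mem_take he)⟩
  have hc : List.IsChain (boundaryGraph D).Adj (p.support.take (k + 1)) :=
    p.isChain_adj_support.take _
  rw [← SimpleGraph.Walk.cons_tail_support, List.take_succ_cons] at hc hlen' ⊢
  have := mem_edgeChains _ _ hc
  rwa [show (List.take k p.support.tail).length = k by simpa using hlen'] at this

/-! ### Exploration of a cluster in an independent field. -/

/-- The set of sites that can be reached from `o` when the site `x` gives access to the sites
of `out x (v x)`. -/
def cluster {ι V : Type*} (out : ι → V → Set ι) (o : ι) (v : ι → V) : Set ι :=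
  {y | Relation.ReflTransGen (fun x y => y ∈ out x (v x)) o y}

section Exploration

variable {ι V : Type*} {out : ι → V → Set ι} {o : ι}

theorem mem_cluster_self (v : ι → V) : o ∈ cluster out o v := Relation.ReflTransGen.refl

theorem mem_cluster_of_mem_out {v : ι → V} {x y : ι} (hx : x ∈ cluster out o v)
    (hy : y ∈ out x (v x)) : y ∈ cluster out o v := Relation.ReflTransGen.tail hx hy

/-- The cluster depends only on the variables of its own sites. -/
theorem cluster_congr {v w : ι → V} (h : ∀ x ∈ cluster out o v, v x = w x) :
    cluster out o w = cluster out o v := by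
  apply Set.Subset.antisymm
  · intro y hy
    induction hy with
    | refl => exact mem_cluster_self v
    | tail _ hxy ih => exact mem_cluster_of_mem_out ih (by rw [h _ ih]; exact hxy)
  · intro y hy
    induction hy with
    | refl => exact mem_cluster_self w
    | tail hx hxy ih => exact mem_cluster_of_mem_out ih (by rw [← h _ hx]; exact hxy)

/-- The cluster is explored by revealing only its own sites, so the coordinates in `A` decide
whether it equals `A`. -/
theorem cluster_eq_iff_of_restrict_eq (A : Finset ι) {v w : ι → V}
    (h : A.restrict v = A.restrict w) :
    cluster out o v = (A : Set ι) ↔ cluster out o w = (A : Set ι) := by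
  have h' : ∀ x ∈ A, v x = w x := fun x hx => congrFun h ⟨x, hx⟩
  constructor
  · intro hv
    rw [cluster_congr (v := v) (w := w) (by rw [hv]; exact h'), hv]
  · intro hw
    rw [cluster_congr (v := w) (w := v) (by rw [hw]; exact fun x hx => (h' x hx).symm), hw]

variable [MeasurableSpace V] [Countable V] [MeasurableSingletonClass V]

theorem measurableSet_of_determined (A : Finset ι) (S : Set (ι → V))
    (h : ∀ v w, A.restrict v = A.restrict w → v ∈ S → w ∈ S) : MeasurableSet S := by
  have : S = A.restrict ⁻¹' (A.restrict '' S) := by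
    ext v
    exact ⟨fun hv => ⟨v, hv, rfl⟩, fun ⟨w, hw, hwv⟩ => h w v hwv hw⟩
  rw [this]
  exact (Finset.measurable_restrict A) (Set.to_countable _).measurableSet

theorem measurableSet_cluster_eq (A : Finset ι) :
    MeasurableSet {v : ι → V | cluster out o v = (A : Set ι)} :=
  measurableSet_of_determined A _ fun _ _ h hv => (cluster_eq_iff_of_restrict_eq A h).1 hv

/-- Change of measure: the event lives on the finitely many coordinates in `A`, with countably many
values, so the bounds on single values multiply over `A` and are then summed. -/
theorem infinitePi_determined_le (μ μ' : ι → Measure V) [∀ i, IsProbabilityMeasure (μ i)]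
    [∀ i, IsProbabilityMeasure (μ' i)] (F : ι → Set V) (ρ : ι → ENNReal)
    (hμ : ∀ i, ∀ a ∈ F i, μ i {a} ≤ ρ i * μ' i {a}) (A : Finset ι) (S : Set (ι → V))
    (h : ∀ v w, A.restrict v = A.restrict w → v ∈ S → w ∈ S) :
    Measure.infinitePi μ {v | v ∈ S ∧ ∀ x ∈ A, v x ∈ F x} ≤
      (∏ x ∈ A, ρ x) * Measure.infinitePi μ' S := by
  have hS : S = A.restrict ⁻¹' (A.restrict '' S) := by
    ext v
    exact ⟨fun hv => ⟨v, hv, rfl⟩, fun ⟨w, hw, hwv⟩ => h w v hwv hw⟩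
  have hS' : {v | v ∈ S ∧ ∀ x ∈ A, v x ∈ F x} =
      A.restrict ⁻¹' (A.restrict '' S ∩ {v | ∀ x : A, v x ∈ F x}) := by
    rw [Set.preimage_inter, ← hS]
    ext v
    simp [Finset.restrict]
  rw [hS', ← Measure.map_apply (Finset.measurable_restrict A) (Set.to_countable _).measurableSet,
    Measure.infinitePi_map_restrict]
  conv_rhs => rw [hS, ← Measure.map_apply (Finset.measurable_restrict A)
    (Set.to_countable _).measurableSet, Measure.infinitePi_map_restrict]
  rw [← Measure.tsum_indicator_apply_singleton _ _ (Set.to_countable _).measurableSet,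
    ← Measure.tsum_indicator_apply_singleton (Measure.pi fun i : A => μ' i) _
      (Set.to_countable _).measurableSet, ← ENNReal.tsum_mul_left]
  refine ENNReal.tsum_le_tsum fun v => ?_
  by_cases hv : v ∈ A.restrict '' S ∩ {v | ∀ x : A, v x ∈ F x}
  · rw [Set.indicator_of_mem hv, Set.indicator_of_mem hv.1, Measure.pi_singleton,
      Measure.pi_singleton, ← Finset.prod_coe_sort A, ← Finset.prod_mul_distrib]
    exact Finset.prod_le_prod' fun i _ => hμ i _ (hv.2 i)
  · rw [Set.indicator_of_notMem hv]
    exact zero_le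

/-- If each site explored satisfies the constraint `F` with probability at most `ρ`, then it is
unlikely that the cluster is finite, that all its sites satisfy their constraints, and that the
product of the `ρ`s over the cluster is small. -/
theorem infinitePi_cluster_le [Countable ι] (μ : ι → Measure V) [∀ i, IsProbabilityMeasure (μ i)]
    (F : ι → Set V) (ρ : ι → ENNReal) (hρ : ∀ i, μ i (F i) ≤ ρ i) (r : ENNReal) :
    Measure.infinitePi μ {v | ∃ A : Finset ι, cluster out o v = (A : Set ι) ∧
      (∀ x ∈ A, v x ∈ F x) ∧ ∏ x ∈ A, ρ x ≤ r} ≤ r := by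
  classical
  -- The tilted law conditions each site on its constraint. A constraint of probability zero needs
  -- no tilting, since the comparison on `F i` is then trivial.
  let μ' : ι → Measure V := fun i => if μ i (F i) = 0 then μ i else cond (μ i) (F i)
  have hμ' : ∀ i, IsProbabilityMeasure (μ' i) := by
    intro i
    by_cases h : μ i (F i) = 0
    · simp only [μ', if_pos h]; infer_instance
    · simp only [μ', if_neg h]; exact cond_isProbabilityMeasure h
  have hle : ∀ i, ∀ a ∈ F i, μ i {a} ≤ ρ i * μ' i {a} := by
    intro i a ha
    by_cases h : μ i (F i) = 0
    · rw [measure_mono_null (Set.singleton_subset_iff.2 ha) h]; exact zero_le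
    · simp only [μ', if_neg h]
      rw [cond_apply (Set.to_countable _).measurableSet,
        Set.inter_eq_self_of_subset_right (Set.singleton_subset_iff.2 ha), ← mul_assoc]
      calc μ i {a} = μ i (F i) * (μ i (F i))⁻¹ * μ i {a} := by
            rw [ENNReal.mul_inv_cancel h (measure_ne_top _ _), one_mul]
        _ ≤ _ := by gcongr; exact hρ i
  let S : Finset ι → Set (ι → V) := fun A => {v | cluster out o v = (A : Set ι)}
  have hdisj : Pairwise (Function.onFun Disjoint S) := by
    intro A B hAB
    rw [Function.onFun, Set.disjoint_left]
    intro v (hA : _ = _) (hB : _ = _)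
    exact hAB (Finset.coe_injective (hA.symm.trans hB))
  calc Measure.infinitePi μ {v | ∃ A : Finset ι, cluster out o v = (A : Set ι) ∧
      (∀ x ∈ A, v x ∈ F x) ∧ ∏ x ∈ A, ρ x ≤ r}
      ≤ Measure.infinitePi μ (⋃ A : Finset ι, {v | (v ∈ S A ∧ ∏ x ∈ A, ρ x ≤ r) ∧
          ∀ x ∈ A, v x ∈ F x}) := by
        refine measure_mono fun v ⟨A, h1, h2, h3⟩ => Set.mem_iUnion.2 ⟨A, ⟨h1, h3⟩, h2⟩
    _ ≤ ∑' A : Finset ι, Measure.infinitePi μ {v | (v ∈ S A ∧ ∏ x ∈ A, ρ x ≤ r) ∧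
          ∀ x ∈ A, v x ∈ F x} := measure_iUnion_le _
    _ ≤ ∑' A : Finset ι, r * Measure.infinitePi μ' (S A) := by
        refine ENNReal.tsum_le_tsum fun A => ?_
        by_cases hA : ∏ x ∈ A, ρ x ≤ r
        · simp only [hA, and_true]
          refine (infinitePi_determined_le μ μ' F ρ hle A (S A) fun v w h hv =>
            (cluster_eq_iff_of_restrict_eq A h).1 hv).trans ?_
          gcongr
        · simp [hA]
    -- The events `S A` are disjoint and the tilted field is a single probability measure for all
    -- `A`, so summing over the shapes costs nothing.
    _ = r * Measure.infinitePi μ' (⋃ A, S A) := by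
        rw [ENNReal.tsum_mul_left, measure_iUnion hdisj fun A => measurableSet_cluster_eq A]
    _ ≤ r := mul_le_of_le_one_right' prob_le_one

end Exploration

/-! ### Hitting probabilities of simple random walk, uniformly in the scale. -/

/-- The unit vector of `ℤ^d` with the given axis and sign. -/
def unitStep {d : ℕ} (q : Fin d × Bool) : Site d := Pi.single q.1 (if q.2 then 1 else -1)

theorem unitStep_apply {d : ℕ} (q : Fin d × Bool) (j : Fin d) :
    unitStep q j = if j = q.1 then (if q.2 then 1 else -1) else 0 := by
  simp [unitStep, Pi.single_apply]

theorem unitStep_injective {d : ℕ} : Function.Injective (unitStep (d := d)) := by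
  rintro ⟨i, a⟩ ⟨j, b⟩ h
  have h1 := congrFun h i
  simp only [unitStep_apply] at h1
  by_cases hij : i = j
  · subst hij
    cases a <;> cases b <;> simp_all
  · cases a <;> simp_all

theorem range_unitStep (d : ℕ) : Set.range (unitStep (d := d)) = unitSteps d := by
  ext e
  constructor
  · rintro ⟨⟨i, a⟩, rfl⟩
    show ∑ j, |unitStep (i, a) j| = 1
    rw [Finset.sum_eq_single i]
    · cases a <;> simp [unitStep_apply]
    · intro j _ hj; simp [unitStep_apply, hj]
    · simp
  · intro (he : ∑ j, |e j| = 1)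
    obtain ⟨i, hi⟩ : ∃ i, e i ≠ 0 := by
      by_contra! h
      simp [h] at he
    have hsplit := Finset.add_sum_erase Finset.univ (fun j => |e j|) (Finset.mem_univ i)
    have hpos : 0 < |e i| := abs_pos.2 hi
    have hnn : 0 ≤ ∑ j ∈ Finset.univ.erase i, |e j| := Finset.sum_nonneg fun j _ => abs_nonneg _
    have hz : ∑ j ∈ Finset.univ.erase i, |e j| = 0 := by omega
    have h1 : |e i| = 1 := by omega
    rw [Finset.sum_eq_zero_iff_of_nonneg fun j _ => abs_nonneg _] at hz
    refine ⟨(i, decide (e i = 1)), funext fun j => ?_⟩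
    rw [unitStep_apply]
    by_cases hj : j = i
    · subst hj
      rcases abs_eq (by norm_num : (0 : ℤ) ≤ 1) |>.1 h1 with h | h <;> simp [h]
    · have := hz j (by simp [hj])
      simp [hj, abs_eq_zero.1 this]

theorem unitStep_mem {d : ℕ} (q : Fin d × Bool) : unitStep q ∈ unitSteps d :=
  range_unitStep d ▸ Set.mem_range_self q

theorem ncard_unitSteps (d : ℕ) : (unitSteps d).ncard = 2 * d := by
  rw [← range_unitStep, ← Set.image_univ, Set.ncard_image_of_injective _ unitStep_injective,
    Set.ncard_univ, Nat.card_eq_fintype_card, Fintype.card_prod, Fintype.card_fin,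
    Fintype.card_bool, mul_comm]

theorem stepLaw_real_singleton {d : ℕ} {e : Site d} (he : e ∈ unitSteps d) :
    (stepLaw d).real {e} = (2 * d : ℝ)⁻¹ := by
  rw [stepLaw, Measure.real, uniformOn, cond_apply (finite_unitSteps d).measurableSet,
    Set.inter_eq_self_of_subset_right (Set.singleton_subset_iff.2 he), Measure.count_singleton,
    Measure.count_apply_finite _ (finite_unitSteps d), mul_one,
    ← Set.ncard_eq_toFinset_card _ (finite_unitSteps d), ncard_unitSteps]
  simp

theorem stepLaw_unitSteps {d : ℕ} (hd : 0 < d) : stepLaw d (unitSteps d) = 1 :=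
  uniformOn_self (finite_unitSteps d) (nonempty_unitSteps hd)

/-- The sum of the first `n` of the steps `s`. -/
def displacement {d N : ℕ} (s : Fin N → Site d) (n : ℕ) : Site d :=
  ∑ k : Fin N, if (k : ℕ) < n then s k else 0

@[simp]
theorem displacement_zero {d N : ℕ} (s : Fin N → Site d) : displacement s 0 = 0 := by
  simp [displacement]

theorem displacement_succ_eq_add_tail {d N : ℕ} (s : Fin (N + 1) → Site d) (n : ℕ) :
    displacement s (n + 1) = s 0 + displacement (Fin.tail s) n := by
  simp [displacement, Fin.sum_univ_succ, Fin.tail]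

/-- The sequences of `N` unit steps along which the walk from `x` visits `B`. -/
def hitSet {d : ℕ} (B : Set (Site d)) (N : ℕ) (x : Site d) : Set (Fin N → Site d) :=
  {s | (∀ k, s k ∈ unitSteps d) ∧ ∃ n ≤ N, x + displacement s n ∈ B}

/-- The law of `N` steps of simple random walk. -/
def stepsLaw (d N : ℕ) : Measure (Fin N → Site d) := Measure.pi fun _ => stepLaw d

theorem isProbabilityMeasure_stepsLaw {d : ℕ} (hd : 0 < d) (N : ℕ) :
    IsProbabilityMeasure (stepsLaw d N) := by
  have := isProbabilityMeasure_stepLaw hd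
  unfold stepsLaw
  infer_instance

theorem stepsLaw_hitSet_of_mem {d : ℕ} (hd : 0 < d) {B : Set (Site d)} (N : ℕ) {x : Site d}
    (hx : x ∈ B) : (stepsLaw d N).real (hitSet B N x) = 1 := by
  have := isProbabilityMeasure_stepLaw hd
  have h : hitSet B N x = Set.univ.pi fun _ => unitSteps d := by
    ext s
    simp only [hitSet, Set.mem_ofPred_eq, Set.mem_univ_pi, and_iff_left_iff_imp]
    exact fun _ => ⟨0, Nat.zero_le _, by simpa using hx⟩
  rw [h, stepsLaw, Measure.real, Measure.pi_pi]
  simp [stepLaw_unitSteps hd]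

/-- Decompose according to the first step: a visit within `N` steps from the new position is a visit
within `N + 1` steps from `x`. Only this inequality is needed. -/
theorem stepsLaw_hitSet_succ {d : ℕ} (hd : 0 < d) (B : Set (Site d)) (N : ℕ) (x : Site d) :
    (2 * d : ℝ)⁻¹ * ∑ q : Fin d × Bool, (stepsLaw d N).real (hitSet B N (x + unitStep q)) ≤
      (stepsLaw d (N + 1)).real (hitSet B (N + 1) x) := by
  have := isProbabilityMeasure_stepLaw hd
  have := isProbabilityMeasure_stepsLaw hd N
  have := isProbabilityMeasure_stepsLaw hd (N + 1)
  let T : Fin d × Bool → Set (Fin (N + 1) → Site d) := fun q =>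
    MeasurableEquiv.piFinSuccAbove (fun _ => Site d) 0 ⁻¹'
      ({unitStep q} ×ˢ hitSet B N (x + unitStep q))
  have hT : ∀ q s, s ∈ T q ↔ s 0 = unitStep q ∧ Fin.tail s ∈ hitSet B N (x + unitStep q) :=
    fun q s => Iff.rfl
  have hmT : ∀ q, MeasurableSet (T q) := fun q =>
    (MeasurableEquiv.piFinSuccAbove (fun _ => Site d) 0).measurable
      (Set.to_countable _).measurableSet
  have hmeas : ∀ q, (stepsLaw d (N + 1)).real (T q) =
      (2 * d : ℝ)⁻¹ * (stepsLaw d N).real (hitSet B N (x + unitStep q)) := by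
    intro q
    have h := (measurePreserving_piFinSuccAbove (fun _ : Fin (N + 1) => stepLaw d) 0).measure_preimage
      (s := {unitStep q} ×ˢ hitSet B N (x + unitStep q))
      (Set.to_countable _).measurableSet.nullMeasurableSet
    rw [Measure.prod_prod] at h
    rw [← stepLaw_real_singleton (unitStep_mem q), Measure.real, Measure.real, Measure.real,
      ← ENNReal.toReal_mul]
    exact congrArg ENNReal.toReal h
  rw [Finset.mul_sum, ← Finset.sum_congr rfl fun q _ => hmeas q,
    ← measureReal_biUnion_finset (fun p _ q _ hpq => ?_) fun q _ => hmT q]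
  · refine measureReal_mono fun s hs => ?_
    simp only [Finset.mem_univ, Set.iUnion_true, Set.mem_iUnion, hT] at hs
    obtain ⟨q, h0, htail, n, hn, hmem⟩ := hs
    refine ⟨Fin.cases (h0 ▸ unitStep_mem q) htail, n + 1, by omega, ?_⟩
    rw [displacement_succ_eq_add_tail, h0, ← add_assoc]
    exact hmem
  · rw [Function.onFun, Set.disjoint_left]
    intro s hs hs'
    exact hpq (unitStep_injective (((hT p s).1 hs).1.symm.trans ((hT q s).1 hs').1))

/-- A strictly subharmonic function off `B` bounds hitting probabilities of `B` from below. -/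
theorem le_stepsLaw_hitSet {d : ℕ} (hd : 0 < d) {B : Set (Site d)} {w : Site d → ℝ} {ε : ℝ}
    (hε : 0 ≤ ε) (h1 : ∀ x, w x ≤ 1)
    (h2 : ∀ x ∉ B, w x ≤ 0 ∨ w x + ε ≤ (2 * d : ℝ)⁻¹ * ∑ q : Fin d × Bool, w (x + unitStep q))
    (N : ℕ) (x : Site d) :
    w x - max 0 (1 - N * ε) ≤ (stepsLaw d N).real (hitSet B N x) := by
  induction N generalizing x with
  | zero =>
    have := h1 x
    simp only [Nat.cast_zero, zero_mul, sub_zero, max_eq_right zero_le_one]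
    exact (by linarith : w x - 1 ≤ 0).trans measureReal_nonneg
  | succ N ih =>
    have hm : 0 ≤ max 0 (1 - ((N + 1 : ℕ) : ℝ) * ε) := le_max_left _ _
    by_cases hx : x ∈ B
    · rw [stepsLaw_hitSet_of_mem hd _ hx]
      linarith [h1 x]
    -- Where `w ≤ 0` the bound is trivial. Elsewhere the gain `ε` from strict subharmonicity pays
    -- for the decrease of the error term in `hmax`.
    rcases h2 x hx with h | h
    · exact (by linarith : _ ≤ (0 : ℝ)).trans measureReal_nonneg
    · refine le_trans ?_ (stepsLaw_hitSet_succ hd B N x)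
      have hd' : (0 : ℝ) < 2 * d := by positivity
      have hsum : (2 * d : ℝ)⁻¹ * ∑ q : Fin d × Bool, w (x + unitStep q) - max 0 (1 - N * ε) ≤
          (2 * d : ℝ)⁻¹ * ∑ q : Fin d × Bool, (stepsLaw d N).real (hitSet B N (x + unitStep q)) := by
        have := Finset.sum_le_sum fun (q : Fin d × Bool) (_ : q ∈ Finset.univ) => ih (x + unitStep q)
        rw [Finset.sum_sub_distrib, Finset.sum_const, Finset.card_univ, Fintype.card_prod,
          Fintype.card_fin, Fintype.card_bool, nsmul_eq_mul] at this
        push_cast at this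
        have h3 := mul_le_mul_of_nonneg_left this (inv_nonneg.2 hd'.le)
        rw [mul_sub, show (d : ℝ) * 2 = 2 * d by ring, inv_mul_cancel_left₀ hd'.ne'] at h3
        exact h3
      have hmax : max 0 (1 - N * ε) ≤ max 0 (1 - ((N + 1 : ℕ) : ℝ) * ε) + ε := by
        refine max_le (by linarith) ?_
        have := le_max_right 0 (1 - ((N + 1 : ℕ) : ℝ) * ε)
        push_cast at this ⊢
        linarith
      linarith

theorem one_add_sq_div_two_le_cosh (t : ℝ) : 1 + t ^ 2 / 2 ≤ Real.cosh t := by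
  have h : Real.cosh t = 1 + 2 * Real.sinh (t / 2) ^ 2 := by
    have h1 := Real.cosh_two_mul (t / 2)
    have h2 := Real.cosh_sq (t / 2)
    rw [show 2 * (t / 2) = t by ring] at h1
    linarith
  have h2 : (t / 2) ^ 2 ≤ Real.sinh (t / 2) ^ 2 := by
    rw [sq_le_sq, Real.abs_sinh]
    exact Real.self_le_sinh_iff.2 (abs_nonneg _)
  rw [h]
  nlinarith

/-- The Gaussian profile `exp (-s |y|²)` is strictly subharmonic for simple random walk away
from the origin. -/
theorem gaussian_laplacian {s a b : ℝ} (hs : 0 < s) (hs' : s ≤ 1 / 2) (hab : 3 ≤ s * (a ^ 2 + b ^ 2)) :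
    s * Real.exp (-s * (a ^ 2 + b ^ 2)) * 2 ≤
      (Real.exp (-s * ((a + 1) ^ 2 + b ^ 2)) + Real.exp (-s * ((a - 1) ^ 2 + b ^ 2)) -
        2 * Real.exp (-s * (a ^ 2 + b ^ 2))) +
      (Real.exp (-s * (a ^ 2 + (b + 1) ^ 2)) + Real.exp (-s * (a ^ 2 + (b - 1) ^ 2)) -
        2 * Real.exp (-s * (a ^ 2 + b ^ 2))) := by
  have key : ∀ t : ℝ, Real.exp (-s * (a ^ 2 + b ^ 2) - s + 2 * s * t) +
      Real.exp (-s * (a ^ 2 + b ^ 2) - s - 2 * s * t) =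
      Real.exp (-s * (a ^ 2 + b ^ 2)) * (Real.exp (-s) * (2 * Real.cosh (2 * s * t))) := by
    intro t
    rw [Real.cosh_eq, sub_eq_add_neg, sub_eq_add_neg, Real.exp_add, Real.exp_add, Real.exp_add,
      Real.exp_add]
    ring
  have e1 := key a
  have e2 := key b
  rw [show -s * (a ^ 2 + b ^ 2) - s + 2 * s * a = -s * ((a - 1) ^ 2 + b ^ 2) by ring,
    show -s * (a ^ 2 + b ^ 2) - s - 2 * s * a = -s * ((a + 1) ^ 2 + b ^ 2) by ring] at e1
  rw [show -s * (a ^ 2 + b ^ 2) - s + 2 * s * b = -s * (a ^ 2 + (b - 1) ^ 2) by ring,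
    show -s * (a ^ 2 + b ^ 2) - s - 2 * s * b = -s * (a ^ 2 + (b + 1) ^ 2) by ring] at e2
  have c1 := one_add_sq_div_two_le_cosh (2 * s * a)
  have c2 := one_add_sq_div_two_le_cosh (2 * s * b)
  have he : 1 - s ≤ Real.exp (-s) := by linarith [Real.add_one_le_exp (-s)]
  have hc : 2 + 6 * s ≤ Real.cosh (2 * s * a) + Real.cosh (2 * s * b) := by nlinarith
  have hprod : (1 - s) * (2 + 6 * s) ≤
      Real.exp (-s) * (Real.cosh (2 * s * a) + Real.cosh (2 * s * b)) :=
    mul_le_mul he hc (by linarith) (Real.exp_pos _).le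
  -- Here `(1 - s) * (2 + 6 * s) = 2 + s + 3 * s * (1 - 2 * s)`, which is where `s ≤ 1 / 2` enters.
  have hfin : 2 + s ≤ Real.exp (-s) * (Real.cosh (2 * s * a) + Real.cosh (2 * s * b)) := by
    nlinarith
  have hE := Real.exp_pos (-s * (a ^ 2 + b ^ 2))
  nlinarith [mul_le_mul_of_nonneg_left hfin hE.le]

/-- A lower bound, uniform in the scale, for the probability that a random walk hits a disc. -/
def hitConst : ℝ := Real.exp (-(27 * (25 / 2))) - Real.exp (-(27 * 13))

theorem hitConst_pos : 0 < hitConst := sub_pos.2 (Real.exp_lt_exp.2 (by norm_num))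

theorem hitConst_le_one : hitConst ≤ 1 := by
  have h1 : Real.exp (-(27 * (25 / 2))) ≤ 1 := Real.exp_le_one_iff.2 (by norm_num)
  exact (sub_le_self _ (Real.exp_pos _).le).trans h1

/-- Apply `le_stepsLaw_hitSet` to a Gaussian profile in the two chosen coordinates, lowered by a
constant. Steps along the other axes do not change it. Only `N₀` depends on `r` and `d`; the bound
does not. -/
theorem exists_hitConst_le {d : ℕ} {i₀ i₁ : Fin d} (hi : i₀ ≠ i₁) {r : ℕ} (hr : 8 ≤ r) :
    ∃ N₀ : ℕ, ∀ N ≥ N₀, ∀ (c : ℤ × ℤ) (B : Set (Site d)),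
      (∀ x : Site d, 9 * ((x i₀ - c.1) ^ 2 + (x i₁ - c.2) ^ 2) < (r : ℤ) ^ 2 → x ∈ B) →
      ∀ x : Site d, 2 * ((x i₀ - c.1) ^ 2 + (x i₁ - c.2) ^ 2) ≤ 25 * (r : ℤ) ^ 2 →
        hitConst ≤ (stepsLaw d N).real (hitSet B N x) := by
  have hd : 0 < d := i₀.pos
  have hr' : (8 : ℝ) ≤ r := by exact_mod_cast hr
  -- With `s = 27 / r ^ 2` the profile has `s |y|² ≥ 3` off the disc of radius `r / 3`, as
  -- `gaussian_laplacian` requires, and `r ≥ 8` gives `s ≤ 1 / 2`. The cutoff at `|y|² = 13 r²` lies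
  -- just beyond the starting region `|y|² ≤ 25 r² / 2`.
  set s : ℝ := 27 / (r : ℝ) ^ 2 with hs
  have hr2 : (0 : ℝ) < (r : ℝ) ^ 2 := by positivity
  have hspos : 0 < s := by positivity
  have hsr : s * (r : ℝ) ^ 2 = 27 := div_mul_cancel₀ _ hr2.ne'
  have hs2 : s ≤ 1 / 2 := by
    rw [hs, div_le_iff₀ hr2]; nlinarith
  have hd' : (0 : ℝ) < d := by exact_mod_cast hd
  set ε : ℝ := s / d * Real.exp (-(27 * 13)) with hε
  have hεpos : 0 < ε := by positivity
  obtain ⟨N₀, hN₀⟩ := exists_nat_ge (1 / ε)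
  refine ⟨N₀, fun N hN c B hB x hx => ?_⟩
  let W : ℝ → ℝ → ℝ := fun a b => Real.exp (-s * (a ^ 2 + b ^ 2))
  let w : Site d → ℝ := fun x => W (x i₀ - c.1) (x i₁ - c.2) - Real.exp (-(27 * 13))
  have hw1 : ∀ x, w x ≤ 1 := by
    intro x
    have h1 : W (x i₀ - c.1) (x i₁ - c.2) ≤ 1 := Real.exp_le_one_iff.2 (by
      have : 0 ≤ s * (((x i₀ : ℝ) - c.1) ^ 2 + ((x i₁ : ℝ) - c.2) ^ 2) := by positivity
      linarith)
    have h2 := Real.exp_pos (-(27 * 13))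
    simp only [w]
    linarith
  have hw2 : ∀ x ∉ B, w x ≤ 0 ∨
      w x + ε ≤ (2 * d : ℝ)⁻¹ * ∑ q : Fin d × Bool, w (x + unitStep q) := by
    intro x hxB
    have hfar : (r : ℝ) ^ 2 ≤ 9 * (((x i₀ : ℝ) - c.1) ^ 2 + ((x i₁ : ℝ) - c.2) ^ 2) := by
      have := not_lt.1 fun h => hxB (hB x h)
      exact_mod_cast this
    rcases le_or_gt (13 * (r : ℝ) ^ 2) (((x i₀ : ℝ) - c.1) ^ 2 + ((x i₁ : ℝ) - c.2) ^ 2) with h | h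
    · left
      refine sub_nonpos.2 (Real.exp_le_exp.2 ?_)
      nlinarith [mul_le_mul_of_nonneg_left h hspos.le]
    · right
      have hlap := gaussian_laplacian hspos hs2 (a := (x i₀ : ℝ) - c.1) (b := (x i₁ : ℝ) - c.2)
        (by nlinarith [mul_le_mul_of_nonneg_left hfar hspos.le])
      have hsum : ∑ q : Fin d × Bool, w (x + unitStep q) = 2 * d * w x +
          ∑ i : Fin d, (w (x + unitStep (i, true)) + w (x + unitStep (i, false)) - 2 * w x) := by
        rw [Fintype.sum_prod_type, Finset.sum_sub_distrib, Finset.sum_const, Finset.card_univ,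
          Fintype.card_fin, nsmul_eq_mul]
        simp only [Fintype.sum_bool]
        ring
      have hΔ : ∑ i : Fin d, (w (x + unitStep (i, true)) + w (x + unitStep (i, false)) - 2 * w x) =
          (w (x + unitStep (i₀, true)) + w (x + unitStep (i₀, false)) - 2 * w x) +
          (w (x + unitStep (i₁, true)) + w (x + unitStep (i₁, false)) - 2 * w x) := by
        refine Finset.sum_eq_add i₀ i₁ hi (fun i _ hii => ?_) (by simp) (by simp)
        simp only [w, Pi.add_apply, unitStep_apply, if_neg hii.1.symm, if_neg hii.2.symm, add_zero]
        ring
      have hbig : s * Real.exp (-(27 * 13)) * 2 ≤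
          ∑ i : Fin d, (w (x + unitStep (i, true)) + w (x + unitStep (i, false)) - 2 * w x) := by
        rw [hΔ]
        have hexp : Real.exp (-(27 * 13)) ≤
            Real.exp (-s * (((x i₀ : ℝ) - c.1) ^ 2 + ((x i₁ : ℝ) - c.2) ^ 2)) :=
          Real.exp_le_exp.2 (by nlinarith [mul_le_mul_of_nonneg_left h.le hspos.le])
        have h3 : s * Real.exp (-(27 * 13)) * 2 ≤
            s * Real.exp (-s * (((x i₀ : ℝ) - c.1) ^ 2 + ((x i₁ : ℝ) - c.2) ^ 2)) * 2 := by gcongr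
        refine h3.trans (hlap.trans (le_of_eq ?_))
        simp only [w, W, Pi.add_apply, unitStep_apply, if_neg hi, if_neg hi.symm, if_true,
          Bool.false_eq_true, if_false, add_zero, Int.cast_add, Int.cast_one, Int.cast_neg]
        ring_nf
      rw [hsum]
      have : (2 * d : ℝ)⁻¹ * (2 * d * w x + s * Real.exp (-(27 * 13)) * 2) = w x + ε := by
        rw [hε]; field_simp
      rw [← this]
      gcongr
  have hmain := le_stepsLaw_hitSet hd hεpos.le hw1 hw2 N x
  have hNε : max 0 (1 - (N : ℝ) * ε) = 0 := by
    refine max_eq_left ?_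
    have h1 : 1 / ε ≤ N := hN₀.trans (by exact_mod_cast hN)
    rw [div_le_iff₀ hεpos] at h1
    linarith
  rw [hNε, sub_zero] at hmain
  refine le_trans (sub_le_sub_right (Real.exp_le_exp.2 ?_) _) hmain
  have hx' : 2 * (((x i₀ : ℝ) - c.1) ^ 2 + ((x i₁ : ℝ) - c.2) ^ 2) ≤ 25 * (r : ℝ) ^ 2 := by
    exact_mod_cast hx
  nlinarith [mul_le_mul_of_nonneg_left hx' hspos.le]

/-! ### Reduction to i.i.d. particles with a bounded horizon. -/

/-- What matters of a site when only its first particle is used, and only for `N` steps: whether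
there is a particle, whether it survives for `N` steps, and the steps. -/
abbrev Frog (d N : ℕ) : Type := Bool × Bool × (Fin N → Site d)

/-- The sites visited by the first particle from `x` in its first `N` steps. -/
def frogOut {d N : ℕ} (x : Site d) (v : Frog d N) : Set (Site d) :=
  {y | v.1 = true ∧ v.2.1 = true ∧ (∀ k, v.2.2 k ∈ unitSteps d) ∧
    ∃ n ≤ N, x + displacement v.2.2 n = y}

/-- The reduced configuration. -/
def frogs {d : ℕ} (N : ℕ) (ω : Config d) (x : Site d) : Frog d N :=
  (decide (1 ≤ count ω x), decide ((N : ℕ∞) < lifetime ω x 0), fun k => ω.2.1 (x, 0, k))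

/-- The law of the reduced configuration at one site. -/
def frogLaw (d N : ℕ) (ν : Measure ℕ) (p : unitInterval) : Measure (Frog d N) :=
  (ν.map fun n => decide (1 ≤ n)).prod
    (((lifetimeLaw p).map fun t => decide ((N : ℕ∞) < t)).prod (stepsLaw d N))

theorem isProbabilityMeasure_frogLaw {d : ℕ} (hd : 0 < d) (N : ℕ) (ν : Measure ℕ)
    [IsProbabilityMeasure ν] (p : unitInterval) : IsProbabilityMeasure (frogLaw d N ν p) := by
  have := isProbabilityMeasure_stepsLaw hd N
  have h1 : IsProbabilityMeasure (ν.map fun n => decide (1 ≤ n)) :=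
    Measure.isProbabilityMeasure_map (measurable_of_countable _).aemeasurable
  have h2 : IsProbabilityMeasure ((lifetimeLaw p).map fun t => decide ((N : ℕ∞) < t)) :=
    Measure.isProbabilityMeasure_map Measurable.of_discrete.aemeasurable
  unfold frogLaw
  infer_instance

theorem measurable_frogs {d : ℕ} (N : ℕ) : Measurable (frogs (d := d) N) := by
  refine measurable_pi_lambda _ fun x => Measurable.prodMk ?_ (Measurable.prodMk ?_ ?_)
  · exact (measurable_of_countable fun n : ℕ => decide (1 ≤ n)).comp
      ((measurable_pi_apply x).comp measurable_fst)
  · exact (Measurable.of_discrete (f := fun t : ℕ∞ => decide ((N : ℕ∞) < t))).comp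
      ((measurable_pi_apply (x, 0)).comp (measurable_snd.comp measurable_snd))
  · exact measurable_pi_lambda _ fun k =>
      (measurable_pi_apply (x, 0, (k : ℕ))).comp (measurable_fst.comp measurable_snd)

/-- Prescribing the reduced variables on `I` is a product of three finite cylinders, one for each
factor of `law`; the walk coordinates involved are `(x, 0, k)` with `k < N`. -/
theorem law_frogs_eq {d : ℕ} (hd : 0 < d) (N : ℕ) (ν : Measure ℕ) [IsProbabilityMeasure ν]
    (p : unitInterval) (I : Finset (Site d)) (v : Site d → Frog d N) :
    law d ν p {ω | ∀ x ∈ I, frogs N ω x = v x} = ∏ x ∈ I, frogLaw d N ν p {v x} := by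
  have := isProbabilityMeasure_stepLaw hd
  let S₁ : Set (Site d → ℕ) := (I : Set (Site d)).pi fun x => {n | decide (1 ≤ n) = (v x).1}
  let J : Finset (Site d × ℕ × ℕ) := I ×ˢ ({0} : Finset ℕ) ×ˢ Finset.range N
  let S₂ : Set (Site d × ℕ × ℕ → Site d) := (J : Set (Site d × ℕ × ℕ)).pi fun q =>
    if h : q.2.2 < N then {(v q.1).2.2 ⟨q.2.2, h⟩} else Set.univ
  let S₃ : Set (Site d × ℕ → ℕ∞) := ((I ×ˢ ({0} : Finset ℕ) : Finset _) : Set (Site d × ℕ)).pi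
    fun q => {t | decide ((N : ℕ∞) < t) = (v q.1).2.1}
  have hset : {ω : Config d | ∀ x ∈ I, frogs N ω x = v x} = S₁ ×ˢ S₂ ×ˢ S₃ := by
    ext ω
    simp only [Set.mem_ofPred_eq, Set.mem_prod, S₁, S₂, S₃, J, Set.mem_pi, frogs, count, lifetime,
      Prod.ext_iff, funext_iff, Finset.coe_product, Finset.mem_coe, Finset.coe_singleton,
      Set.mem_singleton_iff, Finset.coe_range, Set.mem_Iio, Prod.forall]
    constructor
    · intro h
      refine ⟨fun x hx => (h x hx).1, ?_, ?_⟩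
      · rintro x i k ⟨hx, rfl, hk⟩
        rw [dif_pos hk]
        exact funext ((h x hx).2.2 ⟨k, hk⟩)
      · rintro x i ⟨hx, rfl⟩
        exact (h x hx).2.1
    · rintro ⟨h1, h2, h3⟩ x hx
      refine ⟨h1 x hx, h3 x 0 ⟨hx, rfl⟩, fun k j => ?_⟩
      have := h2 x 0 k ⟨hx, rfl, k.2⟩
      rw [dif_pos k.2] at this
      exact congrFun this j
  have hfrog : ∀ x, frogLaw d N ν p {v x} = ν {n | decide (1 ≤ n) = (v x).1} *
      (lifetimeLaw p {t | decide ((N : ℕ∞) < t) = (v x).2.1} *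
        ∏ k : Fin N, stepLaw d {(v x).2.2 k}) := by
    intro x
    rw [frogLaw, ← Set.singleton_prod_singleton (a := (v x).1) (b := (v x).2),
      ← Set.singleton_prod_singleton (a := (v x).2.1) (b := (v x).2.2)]
    have := isProbabilityMeasure_stepsLaw hd N
    rw [Measure.prod_prod, Measure.prod_prod, stepsLaw, Measure.pi_singleton,
      Measure.map_apply (measurable_of_countable _) (measurableSet_singleton _),
      Measure.map_apply Measurable.of_discrete (measurableSet_singleton _)]
    rfl
  rw [hset, law, Measure.prod_prod, Measure.prod_prod, Measure.infinitePi_pi, Measure.infinitePi_pi,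
    Measure.infinitePi_pi, Finset.prod_product, Finset.prod_product]
  · simp only [hfrog, Finset.prod_mul_distrib, Finset.prod_singleton, Finset.prod_product]
    congr 1
    rw [mul_comm]
    congr 1
    refine Finset.prod_congr rfl fun x _ => ?_
    rw [← Fin.prod_univ_eq_prod_range (fun k => stepLaw d (if h : k < N then
      {(v x).2.2 ⟨k, h⟩} else Set.univ))]
    refine Finset.prod_congr rfl fun k _ => ?_
    rw [dif_pos k.2]
  · exact fun _ _ => MeasurableSet.of_discrete
  · exact fun _ _ => MeasurableSet.of_discrete
  · exact fun _ _ => MeasurableSet.of_discrete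

/-- The reduced configuration consists of independent identically distributed variables. -/
theorem map_frogs_law {d : ℕ} (hd : 0 < d) (N : ℕ) (ν : Measure ℕ) [IsProbabilityMeasure ν]
    (p : unitInterval) :
    (law d ν p).map (frogs N) = Measure.infinitePi fun _ : Site d => frogLaw d N ν p := by
  classical
  have := isProbabilityMeasure_frogLaw hd N ν p
  refine IsProjectiveLimit.unique (fun I => ?_) (Measure.isProjectiveLimit_infinitePi _)
  refine Measure.ext_of_singleton fun v => ?_
  rw [Measure.map_map (Finset.measurable_restrict I) (measurable_frogs N),
    Measure.map_apply ((Finset.measurable_restrict I).comp (measurable_frogs N))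
      (measurableSet_singleton _), Measure.pi_singleton]
  let v' : Site d → Frog d N := fun x => if h : x ∈ I then v ⟨x, h⟩ else (true, true, 0)
  have hv' : ∀ x : I, v' x = v x := fun x => dif_pos x.2
  have hset : I.restrict ∘ frogs N ⁻¹' {v} = {ω : Config d | ∀ x ∈ I, frogs N ω x = v' x} := by
    ext ω
    simp only [Set.mem_preimage, Set.mem_singleton_iff, funext_iff, Set.mem_ofPred_eq,
      Function.comp, Finset.restrict]
    exact ⟨fun h x hx => (h ⟨x, hx⟩).trans (hv' ⟨x, hx⟩).symm, fun h x => (h x x.2).trans (hv' x)⟩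
  rw [hset, law_frogs_eq hd, ← Finset.prod_coe_sort]
  simp only [hv']

/-- Each of the values `1, …, N` has mass at most `1 - p`. -/
theorem lifetimeLaw_not_lt_le (p : unitInterval) (N : ℕ) :
    lifetimeLaw p {t | ¬ (N : ℕ∞) < t} ≤ ENNReal.ofReal (N * (1 - p)) := by
  unfold lifetimeLaw
  split_ifs with h
  · have hp : 0 ≤ 1 - (p : ℝ) := sub_nonneg.2 p.2.2
    rw [Measure.sum_apply _ MeasurableSet.of_discrete, tsum_eq_sum (s := Finset.range N)]
    · calc _ ≤ ∑ k ∈ Finset.range N, ENNReal.ofReal (1 - (p : ℝ)) := by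
            refine Finset.sum_le_sum fun k _ => ?_
            rw [Measure.smul_apply, smul_eq_mul]
            exact (mul_le_of_le_one_right' prob_le_one).trans (ENNReal.ofReal_le_ofReal
              (mul_le_of_le_one_right hp (pow_le_one₀ p.2.1 p.2.2)))
        _ = _ := by
            rw [Finset.sum_const, Finset.card_range, nsmul_eq_mul,
              ENNReal.ofReal_mul (Nat.cast_nonneg N), ENNReal.ofReal_natCast]
    · intro k hk
      rw [Finset.mem_range, not_lt] at hk
      have : ((k + 1 : ℕ) : ℕ∞) ∉ {t : ℕ∞ | ¬ (N : ℕ∞) < t} := by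
        simp only [Set.mem_ofPred_eq, not_not]
        exact_mod_cast Nat.lt_succ_of_le hk
      rw [Measure.smul_apply, Measure.dirac_apply' _ MeasurableSet.of_discrete,
        Set.indicator_of_notMem this, smul_zero]
  · have : (⊤ : ℕ∞) ∉ {t : ℕ∞ | ¬ (N : ℕ∞) < t} := by simp
    rw [Measure.dirac_apply' _ MeasurableSet.of_discrete, Set.indicator_of_notMem this]
    exact zero_le

theorem one_half_le_lifetimeLaw_lt {p : unitInterval} {N : ℕ} (h : N * (1 - (p : ℝ)) ≤ 1 / 2) :
    ENNReal.ofReal (1 / 2) ≤ lifetimeLaw p {t | (N : ℕ∞) < t} := by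
  have h1 : {t : ℕ∞ | (N : ℕ∞) < t} = {t | ¬ (N : ℕ∞) < t}ᶜ := by ext; simp
  rw [h1, prob_compl_eq_one_sub MeasurableSet.of_discrete]
  refine le_trans ?_ (tsub_le_tsub_left ((lifetimeLaw_not_lt_le p N).trans
    (ENNReal.ofReal_le_ofReal h)) 1)
  rw [← ENNReal.ofReal_one, ← ENNReal.ofReal_sub _ (by norm_num)]
  norm_num

theorem frogLaw_good {d : ℕ} (hd : 0 < d) (N : ℕ) (ν : Measure ℕ) [IsProbabilityMeasure ν]
    (p : unitInterval) (S : Set (Fin N → Site d)) :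
    frogLaw d N ν p ({true} ×ˢ {true} ×ˢ S) =
      ν {n | 1 ≤ n} * (lifetimeLaw p {t | (N : ℕ∞) < t} * stepsLaw d N S) := by
  have := isProbabilityMeasure_stepsLaw hd N
  rw [frogLaw, Measure.prod_prod, Measure.prod_prod,
    Measure.map_apply (measurable_of_countable _) (measurableSet_singleton _),
    Measure.map_apply Measurable.of_discrete (measurableSet_singleton _)]
  congr 2
  · ext; simp
  · congr 1; ext; simp

/-! ### From an infinite cluster to survival. -/

section Deterministic

variable {d : ℕ} {ω : Config d}

theorem hitTime_le {x y : Site d} {i n : ℕ} (hi : i < count ω x)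
    (hn : (n : ℕ∞) < lifetime ω x i) (h : walk ω x i n = y) : hitTime ω x y ≤ n :=
  iInf_le_of_le i (iInf_le_of_le n (iInf_le_of_le ⟨hi, hn, h⟩ le_rfl))

theorem exists_of_hitTime_eq {x y : Site d} {k : ℕ} (h : hitTime ω x y = k) :
    ∃ i, i < count ω x ∧ (k : ℕ∞) < lifetime ω x i ∧ walk ω x i k = y := by
  have hlt : hitTime ω x y < ((k + 1 : ℕ) : ℕ∞) := by rw [h]; exact_mod_cast Nat.lt_succ_self k
  obtain ⟨i, n, ⟨hi, hn, hw⟩, hnk⟩ : ∃ i : ℕ, ∃ n : ℕ, ∃ _ : i < count ω x ∧ (n : ℕ∞) < lifetime ω x i ∧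
      walk ω x i n = y, (n : ℕ∞) < ((k + 1 : ℕ) : ℕ∞) := by
    simpa only [hitTime, iInf_lt_iff] using hlt
  have h1 : k ≤ n := by
    have := hitTime_le hi hn hw
    rw [h] at this
    exact_mod_cast this
  have h2 : n < k + 1 := by exact_mod_cast hnk
  obtain rfl : n = k := by omega
  exact ⟨i, hi, hn, hw⟩

theorem eq_of_hitTime_eq_zero {x y : Site d} (h : hitTime ω x y = (0 : ℕ)) : x = y := by
  obtain ⟨i, -, -, hw⟩ := exists_of_hitTime_eq h
  simpa [walk] using hw

theorem finite_hitTime_le (ω : Config d) (x : Site d) (n : ℕ) :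
    {y | ∃ k ≤ n, hitTime ω x y = (k : ℕ)}.Finite := by
  refine ((Finset.range (count ω x) ×ˢ Finset.range (n + 1)).finite_toSet.image
    fun q => walk ω x q.1 q.2).subset ?_
  rintro y ⟨k, hk, h⟩
  obtain ⟨i, hi, -, hw⟩ := exists_of_hitTime_eq h
  exact ⟨(i, k), by simp; omega, hw⟩

/-- The site `x` can be reached from the origin along a sequence with total passage time `n`. -/
inductive ReachedAt (ω : Config d) : ℕ → Site d → Prop
  | origin : ReachedAt ω 0 0
  | step {n k : ℕ} {x y : Site d} : ReachedAt ω n x → hitTime ω x y = (k : ℕ) →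
      ReachedAt ω (n + k) y

theorem activationTime_zero (ω : Config d) : activationTime ω 0 = 0 :=
  le_antisymm (iInf_le_of_le 0 (iInf_le_of_le (fun _ => 0) (iInf_le_of_le ⟨rfl, rfl⟩ (by simp))))
    zero_le

theorem activationTime_le_add (ω : Config d) (x y : Site d) :
    activationTime ω y ≤ activationTime ω x + hitTime ω x y := by
  rcases eq_or_ne (activationTime ω x) ⊤ with h | h
  · rw [h, top_add]; exact le_top
  obtain ⟨n, hn⟩ := ENat.ne_top_iff_exists.1 h
  have hlt : activationTime ω x < ((n + 1 : ℕ) : ℕ∞) := by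
    rw [← hn]; exact_mod_cast Nat.lt_succ_self n
  obtain ⟨m, z, ⟨hz0, hzx⟩, hsum⟩ : ∃ m, ∃ z : Fin (m + 1) → Site d,
      ∃ _ : z 0 = 0 ∧ z (Fin.last m) = x,
        ∑ j : Fin m, hitTime ω (z j.castSucc) (z j.succ) < ((n + 1 : ℕ) : ℕ∞) := by
    simpa only [activationTime, iInf_lt_iff] using hlt
  -- Times are integers, so a path with total below `n + 1` is optimal. Appending `y` to it proves
  -- the triangle inequality.
  have hle : ∑ j : Fin m, hitTime ω (z j.castSucc) (z j.succ) ≤ activationTime ω x := by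
    rw [← hn]
    exact Order.lt_add_one_iff_of_not_isMax (by simp) |>.1 (by exact_mod_cast hsum)
  refine le_trans ?_ (add_le_add_left hle _)
  refine iInf_le_of_le (m + 1) (iInf_le_of_le (Fin.snoc z y)
    (iInf_le_of_le ⟨?_, Fin.snoc_last _ _⟩ ?_))
  · rw [← Fin.castSucc_zero, Fin.snoc_castSucc, hz0]
  · rw [Fin.sum_univ_castSucc]
    simp only [← Fin.castSucc_succ, Fin.snoc_castSucc, Fin.succ_last, Fin.snoc_last, hzx]
    exact le_rfl

theorem ReachedAt.of_path {m : ℕ} : ∀ (z : Fin (m + 1) → Site d) (n : ℕ), z 0 = 0 →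
    ∑ j : Fin m, hitTime ω (z j.castSucc) (z j.succ) = n → ReachedAt ω n (z (Fin.last m)) := by
  induction m with
  | zero =>
    intro z n hz hn
    simp only [Finset.univ_eq_empty, Finset.sum_empty] at hn
    obtain rfl : n = 0 := by exact_mod_cast hn.symm
    have : z (Fin.last 0) = 0 := hz
    rw [this]
    exact .origin
  | succ m ih =>
    intro z n hz hn
    rw [Fin.sum_univ_castSucc] at hn
    have htop := WithTop.add_ne_top.1 (hn ▸ ENat.natCast_ne_top n)
    obtain ⟨a, ha⟩ := ENat.ne_top_iff_exists.1 htop.1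
    obtain ⟨b, hb⟩ := ENat.ne_top_iff_exists.1 htop.2
    rw [← ha, ← hb] at hn
    obtain rfl : n = a + b := by exact_mod_cast hn.symm
    have h1 := ih (fun j => z j.castSucc) a hz (by rw [ha]; rfl)
    exact .step h1 (by rw [hb]; rfl)

theorem exists_reachedAt_of_activationTime_le {x : Site d} {n : ℕ} (h : activationTime ω x ≤ n) :
    ∃ k ≤ n, ReachedAt ω k x := by
  have hlt : activationTime ω x < ((n + 1 : ℕ) : ℕ∞) :=
    h.trans_lt (by exact_mod_cast Nat.lt_succ_self n)
  obtain ⟨m, z, ⟨hz0, hzx⟩, hsum⟩ : ∃ m, ∃ z : Fin (m + 1) → Site d,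
      ∃ _ : z 0 = 0 ∧ z (Fin.last m) = x,
        ∑ j : Fin m, hitTime ω (z j.castSucc) (z j.succ) < ((n + 1 : ℕ) : ℕ∞) := by
    simpa only [activationTime, iInf_lt_iff] using hlt
  obtain ⟨k, hk⟩ := ENat.ne_top_iff_exists.1 (hsum.trans_le le_top).ne
  rw [← hk] at hsum
  have hk' : k < n + 1 := by exact_mod_cast hsum
  exact ⟨k, by omega, hzx ▸ ReachedAt.of_path z k hz0 hk.symm⟩

/-- A passage of duration zero does not move. One of positive duration that ends by time `n + 1`
starts at a site reached by time `n`, and the finitely many particles there visit finitely many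
sites in `n + 1` steps. -/
theorem finite_reachedAt_le (ω : Config d) (n : ℕ) : {x | ∃ k ≤ n, ReachedAt ω k x}.Finite := by
  induction n with
  | zero =>
    refine (Set.finite_singleton 0).subset ?_
    rintro x ⟨k, hk, h⟩
    induction h with
    | origin => rfl
    | @step n k x y _ hxy ih =>
      obtain ⟨rfl, rfl⟩ : n = 0 ∧ k = 0 := by omega
      rw [← eq_of_hitTime_eq_zero hxy]
      exact ih le_rfl
  | succ n ih =>
    refine (ih.union (ih.biUnion fun x _ => finite_hitTime_le ω x (n + 1))).subset ?_
    rintro x ⟨k, hk, h⟩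
    induction h with
    | origin => exact Or.inl ⟨0, Nat.zero_le _, .origin⟩
    | @step m k x y hx hxy ihx =>
      rcases Nat.eq_zero_or_pos k with rfl | hkpos
      · rw [← eq_of_hitTime_eq_zero hxy]
        exact ihx hk
      · exact Or.inr (Set.mem_biUnion (show x ∈ {x | ∃ k ≤ n, ReachedAt ω k x} from
          ⟨m, by omega, hx⟩) ⟨k, by omega, hxy⟩)

/-- Some passage on the way leads from a site activated by time `n` to one activated later. The
particle that realizes this passage is still alive at time `n`. -/
theorem ReachedAt.exists_isActive {n k : ℕ} {x : Site d} (h : ReachedAt ω k x)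
    (hn : ¬ activationTime ω x ≤ n) : ∃ y i, IsActive ω y i n := by
  induction h with
  | origin => rw [activationTime_zero] at hn; exact absurd zero_le hn
  | @step m k x y _ hxy ih =>
    by_cases hx : activationTime ω x ≤ n
    · obtain ⟨i, hi, hl, -⟩ := exists_of_hitTime_eq hxy
      refine ⟨x, i, hi, hx, ?_⟩
      calc (n : ℕ∞) < activationTime ω y := not_le.1 hn
        _ ≤ activationTime ω x + hitTime ω x y := activationTime_le_add ω x y
        _ ≤ activationTime ω x + lifetime ω x i := by rw [hxy]; gcongr
    · exact ih hx

/-- If infinitely many sites can be reached, then the frog model survives. -/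
theorem survives_of_infinite (h : {x | ∃ k, ReachedAt ω k x}.Infinite) : Survives ω := by
  intro n
  obtain ⟨x, ⟨k, hx⟩, hn⟩ := h.exists_notMem_finite (finite_reachedAt_le ω n)
  exact hx.exists_isActive fun hle => hn (exists_reachedAt_of_activationTime_le hle)

theorem displacement_eq_sum_range {N n : ℕ} (hn : n ≤ N) (f : ℕ → Site d) :
    displacement (fun k : Fin N => f k) n = ∑ k ∈ Finset.range n, f k := by
  rw [displacement, Fin.sum_univ_eq_sum_range (fun k => if k < n then f k else 0) N,
    ← Finset.sum_filter]
  congr 1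
  ext k
  simp only [Finset.mem_filter, Finset.mem_range]
  omega

/-- A link of the cluster is made by a particle that outlives its first `N` steps, so it is a
passage of finite time. -/
theorem survives_of_infinite_cluster {N : ℕ} (h : (cluster frogOut 0 (frogs N ω)).Infinite) :
    Survives ω := by
  refine survives_of_infinite (h.mono fun y hy => ?_)
  induction hy with
  | refl => exact ⟨0, .origin⟩
  | @tail x y _ hxy ih =>
    obtain ⟨m, hm⟩ := ih
    obtain ⟨h1, h2, -, n, hn, hy⟩ := hxy
    simp only [frogs, decide_eq_true_eq] at h1 h2
    have hw : walk ω x 0 n = y := by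
      rw [walk, ← displacement_eq_sum_range hn fun k => ω.2.1 (x, 0, k)]
      exact hy
    have hle : hitTime ω x y ≤ n := hitTime_le h1 (lt_of_le_of_lt (by exact_mod_cast hn) h2) hw
    obtain ⟨k, hk⟩ := ENat.ne_top_iff_exists.1 (hle.trans_lt (ENat.natCast_lt_top n)).ne
    exact ⟨m + k, hm.step hk.symm⟩

end Deterministic

/-! ### Lattice connectivity and the block projection. -/

theorem displacement_succ {d N n : ℕ} (s : Fin N → Site d) (h : n < N) :
    displacement s (n + 1) = displacement s n + s ⟨n, h⟩ := by
  have hk : ∀ k : Fin N, (if (k : ℕ) < n + 1 then s k else 0) =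
      (if (k : ℕ) < n then s k else 0) + if k = ⟨n, h⟩ then s k else 0 := by
    intro k
    by_cases h1 : k = ⟨n, h⟩
    · subst h1; simp
    · have h2 : (k : ℕ) ≠ n := fun hh => h1 (Fin.ext hh)
      have h3 : (k : ℕ) < n + 1 ↔ (k : ℕ) < n := by omega
      simp [h1, h3]
  simp only [displacement, hk, Finset.sum_add_distrib, Finset.sum_ite_eq', Finset.mem_univ, if_true]

/-- Nearest-neighbour steps within `C`. -/
def StepIn {d : ℕ} (C : Set (Site d)) (x y : Site d) : Prop :=
  x ∈ C ∧ y ∈ C ∧ y - x ∈ unitSteps d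

theorem StepIn.symm {d : ℕ} {C : Set (Site d)} {x y : Site d} (h : StepIn C x y) :
    StepIn C y x := by
  refine ⟨h.2.1, h.1, ?_⟩
  have : ∑ j, |(y - x) j| = 1 := h.2.2
  show ∑ j, |(x - y) j| = 1
  rw [← this]
  exact Finset.sum_congr rfl fun j _ => abs_sub_comm _ _

/-- The cluster of the origin is connected in the lattice. -/
theorem reflTransGen_stepIn_cluster {d N : ℕ} {v : Site d → Frog d N} {y : Site d}
    (hy : y ∈ cluster frogOut 0 v) :
    Relation.ReflTransGen (StepIn (cluster frogOut 0 v)) 0 y := by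
  induction hy with
  | refl => exact .refl
  | @tail x y hx hxy ih =>
    refine ih.trans ?_
    obtain ⟨h1, h2, h3, n, hn, rfl⟩ := hxy
    have hmem : ∀ m ≤ N, x + displacement (v x).2.2 m ∈ cluster frogOut 0 v := fun m hm =>
      mem_cluster_of_mem_out hx ⟨h1, h2, h3, m, hm, rfl⟩
    clear ih
    induction n with
    | zero => rw [displacement_zero, add_zero]
    | succ n ihn =>
      refine (ihn (by omega)).tail ⟨hmem n (by omega), hmem _ hn, ?_⟩
      rw [displacement_succ _ (by omega : n < N), add_sub_add_left_eq_sub, add_sub_cancel_left]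
      exact h3 _

section Blocks

variable {d : ℕ} (i₀ i₁ : Fin d) (r : ℕ)

/-- The index of the block of side `r` that contains the projection of `x` to the plane of
the axes `i₀` and `i₁`. -/
def block (x : Site d) : ℤ × ℤ := (x i₀ / r, x i₁ / r)

/-- The block of `x` is within sup-distance one of `b`. -/
def NearBlock (x : Site d) (b : ℤ × ℤ) : Prop :=
  |b.1 - (block i₀ i₁ r x).1| ≤ 1 ∧ |b.2 - (block i₀ i₁ r x).2| ≤ 1

theorem abs_ediv_sub_ediv_le {r : ℕ} (hr : 0 < r) {a b : ℤ} (h : |a - b| ≤ r) :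
    |a / r - b / r| ≤ 1 := by
  have hr' : (0 : ℤ) < r := by exact_mod_cast hr
  have key : ∀ a b : ℤ, a ≤ b + r → a / r ≤ b / r + 1 := by
    intro a b hab
    calc a / r ≤ (b + r) / r := Int.ediv_le_ediv hr' hab
      _ = b / r + 1 := by rw [Int.add_ediv_of_dvd_right dvd_rfl, Int.ediv_self hr'.ne']
  rw [abs_le] at h ⊢
  have h1 := key a b (by omega)
  have h2 := key b a (by omega)
  omega

/-- A unit step changes at most one of the two distinct coordinates, and by no more than `r`, so the
block stays or moves to a nearest neighbour. -/
theorem block_add_unitStep {r : ℕ} (hr : 0 < r) (hi : i₀ ≠ i₁) {x y : Site d}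
    (h : y - x ∈ unitSteps d) :
    block i₀ i₁ r y = block i₀ i₁ r x ∨ block i₀ i₁ r y - block i₀ i₁ r x ∈ planarSteps := by
  rw [← range_unitStep] at h
  obtain ⟨q, hq⟩ := h
  have h0 : |y i₀ - x i₀| ≤ r ∧ |y i₁ - x i₁| ≤ r ∧ (y i₀ = x i₀ ∨ y i₁ = x i₁) := by
    have e0 := congrFun hq i₀
    have e1 := congrFun hq i₁
    rw [unitStep_apply, Pi.sub_apply] at e0 e1
    rw [← e0, ← e1]
    by_cases h0 : i₀ = q.1
    · have h1 : i₁ ≠ q.1 := fun h => hi (h0.trans h.symm)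
      rw [if_neg h1] at e1
      refine ⟨?_, ?_, Or.inr (by omega)⟩ <;> split_ifs <;> simp <;> omega
    · rw [if_neg h0] at e0
      refine ⟨?_, ?_, Or.inl (by omega)⟩ <;> split_ifs <;> simp <;> omega
  obtain ⟨ha, hb, hc⟩ := h0
  have ha' := abs_le.1 (abs_ediv_sub_ediv_le hr ha)
  have hb' := abs_le.1 (abs_ediv_sub_ediv_le hr hb)
  rw [mem_planarSteps]
  simp only [block, Prod.ext_iff, Prod.fst_sub, Prod.snd_sub]
  rcases hc with hc | hc <;> rw [hc] at * <;> omega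

theorem block_connected {r : ℕ} (hr : 0 < r) (hi : i₀ ≠ i₁) {C : Set (Site d)} {y : Site d}
    (hy : Relation.ReflTransGen (StepIn C) 0 y) :
    Relation.ReflTransGen (fun u v => u ∈ block i₀ i₁ r '' C ∧ v ∈ block i₀ i₁ r '' C ∧
      v - u ∈ planarSteps) (0, 0) (block i₀ i₁ r y) := by
  induction hy with
  | refl => simp [block, Relation.ReflTransGen.refl]
  | tail _ h ih =>
    rcases block_add_unitStep i₀ i₁ hr hi h.2.2 with he | he
    · rwa [he]
    · exact ih.tail ⟨⟨_, h.1, rfl⟩, ⟨_, h.2.1, rfl⟩, he⟩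

-- The sup-distance from `y` in the projected plane changes by at most one along a step. It reaches
-- `r` on `A`: at the origin if `|y i₀| ≥ r`, and otherwise at `z`, whose coordinate `3 r` is far
-- enough. So it takes all values `0, …, r`, and erasing the origin leaves `r` sites.
open Classical in
theorem le_card_nearBlock {r : ℕ} (hr : 0 < r) {A : Finset (Site d)}
    (hconn : ∀ y ∈ A, Relation.ReflTransGen (StepIn (A : Set (Site d))) 0 y) {z : Site d}
    (hz : z ∈ A) (hzr : z i₀ = 3 * r) {y : Site d} (hy : y ∈ A) :
    r ≤ ((A.erase 0).filter fun x => NearBlock i₀ i₁ r x (block i₀ i₁ r y)).card := by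
  let f : Site d → ℤ := fun x => max |x i₀ - y i₀| |x i₁ - y i₁|
  have hf : ∀ x x', StepIn (A : Set (Site d)) x x' → f x' ≤ f x + 1 := by
    intro x x' h
    have hj : ∀ j, |x' j - x j| ≤ 1 := by
      have h1 : ∑ j, |(x' - x) j| = 1 := h.2.2
      intro j
      exact (Finset.single_le_sum (f := fun j => |(x' - x) j|) (fun i _ => abs_nonneg _)
        (Finset.mem_univ j)).trans_eq h1
    have hj' : ∀ j, |x' j - y j| ≤ |x j - y j| + 1 := fun j => by
      have := abs_sub_le (x' j) (x j) (y j)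
      linarith [hj j]
    exact max_le ((hj' i₀).trans (by gcongr; exact le_max_left _ _))
      ((hj' i₁).trans (by gcongr; exact le_max_right _ _))
  have hivt : ∀ w, Relation.ReflTransGen (StepIn (A : Set (Site d))) y w →
      ∀ t, 0 ≤ t → t ≤ f w → ∃ x ∈ A, f x = t := by
    intro w hw
    induction hw with
    | refl =>
      intro t ht ht'
      have : f y = 0 := by simp [f]
      exact ⟨y, hy, by omega⟩
    | @tail b c _ hbc ih =>
      intro t ht ht'
      by_cases h : t ≤ f b
      · exact ih t ht h
      · exact ⟨c, hbc.2.1, by have := hf b c hbc; omega⟩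
  have hy0 : Relation.ReflTransGen (StepIn (A : Set (Site d))) y 0 :=
    have : Std.Symm (StepIn (A : Set (Site d))) := ⟨fun _ _ h => h.symm⟩
    Relation.ReflTransGen.stdSymm.symm _ _ (hconn y hy)
  have hfar : ∃ w, Relation.ReflTransGen (StepIn (A : Set (Site d))) y w ∧ (r : ℤ) ≤ f w := by
    rcases le_or_gt (r : ℤ) |y i₀| with h | h
    · exact ⟨0, hy0, h.trans (le_trans (by simp) (le_max_left _ _))⟩
    · refine ⟨z, hy0.trans (hconn z hz), le_trans ?_ (le_max_left _ _)⟩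
      rw [hzr]
      rw [abs_lt] at h
      exact le_trans (by omega) (le_abs_self _)
  obtain ⟨w, hw, hrw⟩ := hfar
  have hsub : Finset.Icc (0 : ℤ) r ⊆
      (A.filter fun x => NearBlock i₀ i₁ r x (block i₀ i₁ r y)).image f := by
    intro t ht
    rw [Finset.mem_Icc] at ht
    obtain ⟨x, hx, hxt⟩ := hivt w hw t ht.1 (ht.2.trans hrw)
    refine Finset.mem_image.2 ⟨x, Finset.mem_filter.2 ⟨hx, ?_, ?_⟩, hxt⟩
    · refine abs_ediv_sub_ediv_le hr ?_
      rw [abs_sub_comm]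
      exact (le_max_left _ _).trans (hxt.trans_le ht.2)
    · refine abs_ediv_sub_ediv_le hr ?_
      rw [abs_sub_comm]
      exact (le_max_right _ _).trans (hxt.trans_le ht.2)
  have hcard := (Finset.card_le_card hsub).trans Finset.card_image_le
  rw [Int.card_Icc] at hcard
  rw [Finset.filter_erase]
  have := Finset.pred_card_le_card_erase
    (s := A.filter fun x => NearBlock i₀ i₁ r x (block i₀ i₁ r y)) (a := 0)
  omega

-- Double counting: the edges of `l` near a given site all belong to `edgesNear` of its block, which
-- has at most 36 elements.
open Classical in
theorem card_mul_le_card_nearBlock {L : ℕ} (hrL : r = 36 * L) (S : Finset (Site d))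
    (l : Finset ((ℤ × ℤ) × (ℤ × ℤ))) (hl : ∀ e ∈ l, e.2 - e.1 ∈ planarSteps)
    (h : ∀ e ∈ l, r ≤ (S.filter fun x => NearBlock i₀ i₁ r x e.1).card) :
    l.card * L ≤ (S.filter fun x => ∃ e ∈ l, NearBlock i₀ i₁ r x e.1).card := by
  have hcard : ∀ x, (l.filter fun e => NearBlock i₀ i₁ r x e.1).card ≤ 36 := by
    intro x
    have hsub : (l.filter fun e => NearBlock i₀ i₁ r x e.1) ⊆ edgesNear (block i₀ i₁ r x) := by
      intro e he
      rw [Finset.mem_filter] at he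
      exact mem_edgesNear he.2.1 he.2.2 (hl e he.1)
    exact (Finset.card_le_card hsub).trans (card_edgesNear_le _)
  have hzero : ∀ x, (¬ ∃ e ∈ l, NearBlock i₀ i₁ r x e.1) →
      (l.filter fun e => NearBlock i₀ i₁ r x e.1).card = 0 := by
    intro x hx
    rw [Finset.card_eq_zero, Finset.filter_eq_empty_iff]
    exact fun e he hne => hx ⟨e, he, hne⟩
  have hcount : l.card * r ≤
      (S.filter fun x => ∃ e ∈ l, NearBlock i₀ i₁ r x e.1).card * 36 :=
    calc l.card * r ≤ ∑ e ∈ l, (S.filter fun x => NearBlock i₀ i₁ r x e.1).card :=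
          (smul_eq_mul _ _).symm.trans_le (Finset.card_nsmul_le_sum _ _ _ h)
      _ = ∑ x ∈ S, (l.filter fun e => NearBlock i₀ i₁ r x e.1).card := by
          simp only [Finset.card_filter]
          exact Finset.sum_comm
      _ = ∑ x ∈ S.filter fun x => ∃ e ∈ l, NearBlock i₀ i₁ r x e.1,
            (l.filter fun e => NearBlock i₀ i₁ r x e.1).card := by
          refine (Finset.sum_subset (Finset.filter_subset _ _) fun x hx hx' => ?_).symm
          exact hzero x fun hex => hx' (Finset.mem_filter.2 ⟨hx, hex⟩)
      _ ≤ _ := (Finset.sum_le_card_nsmul _ _ _ fun x _ => hcard x).trans_eq (smul_eq_mul _ _)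
  have hmul : l.card * L * 36 = l.card * r := by rw [hrL]; ring
  exact Nat.le_of_mul_le_mul_right (hmul.le.trans hcount) (by norm_num)

/-- From a site near a block, the walk has a uniformly positive chance to enter any adjacent
block. -/
theorem exists_hitConst_le_block {L : ℕ} (hL : 0 < L) (hrL : r = 36 * L) (hi : i₀ ≠ i₁) :
    ∃ N₀ : ℕ, ∀ N ≥ N₀, ∀ (e : (ℤ × ℤ) × (ℤ × ℤ)) (x : Site d), e.2 - e.1 ∈ planarSteps →
      NearBlock i₀ i₁ r x e.1 →
        hitConst ≤ (stepsLaw d N).real (hitSet {z | block i₀ i₁ r z = e.2} N x) := by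
  obtain ⟨N₀, hN₀⟩ := exists_hitConst_le hi (r := r) (by omega)
  refine ⟨N₀, fun N hN e x he hx => ?_⟩
  have hr' : (0 : ℤ) < r := by omega
  have hr36 : (r : ℤ) = 36 * L := by exact_mod_cast hrL
  have hLpos : (0 : ℤ) < L := by exact_mod_cast hL
  -- The target is the disc of radius `r / 3 = 12 L` about the centre of the block `e.2`, which fits
  -- in the half-side `18 L`. The block of `x` is within two of `e.2` in each coordinate, so `x` is
  -- within `5 r / 2` of that centre in each coordinate; this is the origin of the constant `25 /
  -- 2`.
  refine hN₀ N hN (e.2.1 * r + 18 * L, e.2.2 * r + 18 * L) _ ?_ x ?_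
  · intro z hz
    have key : ∀ a b c : ℤ, 9 * ((a - (b * r + 18 * L)) ^ 2 + c ^ 2) < (r : ℤ) ^ 2 → a / r = b := by
      intro a b c habc
      have h1 : |a - (b * r + 18 * L)| < 12 * L := by
        refine abs_lt_of_sq_lt_sq ?_ (by omega)
        rw [hr36] at habc ⊢
        nlinarith [sq_nonneg c]
      rw [abs_lt] at h1
      refine le_antisymm (Int.lt_add_one_iff.1 ((Int.ediv_lt_iff_lt_mul hr').2 ?_))
        ((Int.le_ediv_iff_mul_le hr').2 ?_)
      · rw [add_mul]; omega
      · omega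
    exact Prod.ext (key _ _ _ hz) (key _ _ _ (by rw [add_comm (_ ^ 2)]; exact hz))
  · have key : ∀ a b c : ℤ, |c - a / r| ≤ 1 → |b - c| ≤ 1 →
        4 * (a - (b * r + 18 * L)) ^ 2 ≤ 25 * (r : ℤ) ^ 2 := by
      intro a b c h1 h2
      have h3 := Int.emod_add_mul_ediv a r
      have h4 := Int.emod_nonneg a hr'.ne'
      have h5 := Int.emod_lt_of_pos a hr'
      rw [abs_le] at h1 h2
      have h6 : (r : ℤ) * (a / r - b) ≤ r * 2 := mul_le_mul_of_nonneg_left (by omega) hr'.le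
      have h7 : (r : ℤ) * (-2) ≤ r * (a / r - b) := mul_le_mul_of_nonneg_left (by omega) hr'.le
      have h8 : a - (b * r + 18 * L) = r * (a / r - b) + (a % r - 18 * L) := by
        rw [mul_sub, mul_comm b]; linarith
      have h9 : |2 * (a - (b * r + 18 * L))| ≤ |5 * (r : ℤ)| := by
        rw [h8, abs_of_pos (by omega : 0 < 5 * (r : ℤ)), abs_le]
        constructor <;> linarith
      have := sq_le_sq.2 h9
      linarith
    have he' : |e.2.1 - e.1.1| ≤ 1 ∧ |e.2.2 - e.1.2| ≤ 1 := by
      rw [mem_planarSteps] at he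
      simp only [Prod.ext_iff, Prod.fst_sub, Prod.snd_sub] at he
      rw [abs_le, abs_le]
      omega
    have k1 := key _ _ _ hx.1 he'.1
    have k2 := key _ _ _ hx.2 he'.2
    simp only
    linarith

end Blocks

/-! ### The Peierls estimate. -/

/-- A particle that exists, lives long enough and moves straight along the axis `i₀`. -/
def straightFrog {d : ℕ} (N : ℕ) (i₀ : Fin d) : Frog d N :=
  (true, true, fun _ => unitStep (i₀, true))

theorem mem_frogOut_straightFrog {d N n : ℕ} (i₀ : Fin d) (hn : n ≤ N) :
    n • unitStep (i₀, true) ∈ frogOut 0 (straightFrog N i₀) := by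
  refine ⟨rfl, rfl, fun _ => unitStep_mem _, n, hn, ?_⟩
  rw [zero_add]
  exact (displacement_eq_sum_range hn fun _ => unitStep (i₀, true)).trans (by simp)

/-- The reduced configurations in which the first particle of `x` enters `B`. -/
def enterSet {d : ℕ} (N : ℕ) (B : Set (Site d)) (x : Site d) : Set (Frog d N) :=
  {true} ×ˢ {true} ×ˢ hitSet B N x

theorem exists_mem_frogOut_of_mem_enterSet {d N : ℕ} {B : Set (Site d)} {x : Site d}
    {v : Frog d N} (h : v ∈ enterSet N B x) : ∃ y ∈ B, y ∈ frogOut x v := by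
  obtain ⟨h1, h2, h3, n, hn, hy⟩ := h
  exact ⟨_, hy, h1, h2, h3, n, hn, rfl⟩

section Percolation

variable {d N : ℕ} (i₀ i₁ : Fin d) (r L : ℕ) (μ : Measure (Frog d N))

/-- The constraints that a chain `l` of boundary edges puts on the particles, together with the
requirement that the particle of the origin goes straight. -/
def chainConstraint (l : List ((ℤ × ℤ) × (ℤ × ℤ))) (x : Site d) : Set (Frog d N) :=
  {v | (x = 0 → v = straightFrog N i₀) ∧
    (x ≠ 0 → ∀ e ∈ l, e.2 - e.1 ∈ planarSteps → NearBlock i₀ i₁ r x e.1 →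
      v ∉ enterSet N {z | block i₀ i₁ r z = e.2} x)}

open Classical in
/-- Bounds for the probabilities of the constraints `chainConstraint`. -/
def chainWeight (β : ENNReal) (l : List ((ℤ × ℤ) × (ℤ × ℤ))) (x : Site d) : ENNReal :=
  if x = 0 then μ {straightFrog N i₀}
  else if ∃ e ∈ l.toFinset, NearBlock i₀ i₁ r x e.1 then β else 1

variable {i₀ i₁ r L μ}

theorem measure_chainConstraint_le [IsProbabilityMeasure μ] {β : ENNReal}
    (hβ : ∀ (e : (ℤ × ℤ) × (ℤ × ℤ)) (x : Site d), e.2 - e.1 ∈ planarSteps →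
      NearBlock i₀ i₁ r x e.1 → μ (enterSet N {z | block i₀ i₁ r z = e.2} x)ᶜ ≤ β)
    {l : List ((ℤ × ℤ) × (ℤ × ℤ))} (hl : ∀ e ∈ l, e.2 - e.1 ∈ planarSteps) (x : Site d) :
    μ (chainConstraint i₀ i₁ r l x) ≤ chainWeight i₀ i₁ r μ β l x := by
  unfold chainWeight
  split_ifs with h0 h1
  · exact measure_mono fun v hv => hv.1 h0
  · obtain ⟨e, he, hx⟩ := h1
    rw [List.mem_toFinset] at he
    exact (measure_mono fun v hv => hv.2 h0 e he (hl e he) hx).trans (hβ e x (hl e he) hx)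
  · exact prob_le_one

/-- The straight particle of the origin puts a site at distance `3 r` into the cluster, which makes
it large enough for `le_card_nearBlock`. At least `L` sites per edge then carry the weight `β`, and
the origin carries the remaining factor. -/
theorem prod_chainWeight_le {β : ENNReal} (hβ1 : β ≤ 1) (hL : 0 < L) (hrL : r = 36 * L)
    {l : List ((ℤ × ℤ) × (ℤ × ℤ))} (hnodup : l.Nodup) (hN : 3 * r ≤ N) {v : Site d → Frog d N}
    (hv0 : v 0 = straightFrog N i₀) {A : Finset (Site d)}
    (hA : cluster frogOut 0 v = (A : Set (Site d)))
    (hl : ∀ e ∈ l, IsBoundaryEdge (block i₀ i₁ r '' (A : Set (Site d))) e) :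
    ∏ x ∈ A, chainWeight i₀ i₁ r μ β l x ≤ μ {straightFrog N i₀} * (β ^ L) ^ l.length := by
  classical
  have hr : 0 < r := by omega
  have h0 : (0 : Site d) ∈ A := by
    rw [← Finset.mem_coe, ← hA]; exact mem_cluster_self v
  have hconn : ∀ y ∈ A, Relation.ReflTransGen (StepIn (A : Set (Site d))) 0 y := by
    intro y hy
    rw [← Finset.mem_coe, ← hA] at hy
    exact hA ▸ reflTransGen_stepIn_cluster hy
  have hz : (3 * r) • unitStep (i₀, true) ∈ A := by
    rw [← Finset.mem_coe, ← hA]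
    exact mem_cluster_of_mem_out (mem_cluster_self v)
      (hv0 ▸ mem_frogOut_straightFrog i₀ hN)
  have hzr : ((3 * r) • unitStep (i₀, true) : Site d) i₀ = 3 * r := by
    simp [unitStep_apply]
  have hcount := card_mul_le_card_nearBlock i₀ i₁ r hrL (A.erase 0) l.toFinset
    (fun e he => (hl e (List.mem_toFinset.1 he)).2.2) (by
      intro e he
      obtain ⟨y, hy, hye⟩ := (hl e (List.mem_toFinset.1 he)).1
      rw [← hye]
      exact le_card_nearBlock i₀ i₁ hr hconn hz hzr hy)
  rw [List.toFinset_card_of_nodup hnodup] at hcount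
  rw [← Finset.mul_prod_erase A _ h0]
  have hprod : ∏ x ∈ A.erase 0, chainWeight i₀ i₁ r μ β l x =
      β ^ ((A.erase 0).filter fun x => ∃ e ∈ l.toFinset, NearBlock i₀ i₁ r x e.1).card := by
    rw [← Finset.prod_const, Finset.prod_filter]
    refine Finset.prod_congr rfl fun x hx => ?_
    unfold chainWeight
    rw [if_neg (Finset.ne_of_mem_erase hx)]
  rw [hprod, ← pow_mul, mul_comm L]
  refine mul_le_mul' ?_ (pow_le_pow_right_of_le_one' hβ1 hcount)
  unfold chainWeight
  rw [if_pos rfl]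

/-- Under the conditions of the block construction the cluster of the origin is infinite
with positive probability. -/
theorem infinitePi_infinite_cluster_pos [IsProbabilityMeasure μ] {β : ENNReal} (hβ1 : β ≤ 1)
    (hL : 0 < L) (hrL : r = 36 * L) (hN : 3 * r ≤ N) (hi : i₀ ≠ i₁)
    (hβ : ∀ (e : (ℤ × ℤ) × (ℤ × ℤ)) (x : Site d), e.2 - e.1 ∈ planarSteps →
      NearBlock i₀ i₁ r x e.1 → μ (enterSet N {z | block i₀ i₁ r z = e.2} x)ᶜ ≤ β)
    (hβL : 36 * β ^ L ≤ 4⁻¹) (hpos : μ {straightFrog N i₀} ≠ 0) :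
    0 < Measure.infinitePi (fun _ : Site d => μ) {v | (cluster frogOut 0 v).Infinite} := by
  set P := Measure.infinitePi (fun _ : Site d => μ) with hP
  set g := μ {straightFrog N i₀} with hg
  have hr : 0 < r := by omega
  let bad : ℕ → List ((ℤ × ℤ) × (ℤ × ℤ)) → Set (Site d → Frog d N) := fun k l =>
    {v | v 0 = straightFrog N i₀ ∧ l.Nodup ∧ l.length = k + 1 ∧
      ∃ A : Finset (Site d), cluster frogOut 0 v = (A : Set (Site d)) ∧
        ∀ e ∈ l, IsBoundaryEdge (block i₀ i₁ r '' (A : Set (Site d))) e}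
  -- The factor `g` is kept because `g` may be tiny: the bound must be compared with the probability
  -- of the straight start, not with one.
  have hbad : ∀ k l, P (bad k l) ≤ g * (β ^ L) ^ (k + 1) := by
    intro k l
    by_cases hl : ∀ e ∈ l, e.2 - e.1 ∈ planarSteps
    · refine le_trans (measure_mono ?_) (infinitePi_cluster_le (out := frogOut) (o := 0)
        (fun _ => μ) (chainConstraint i₀ i₁ r l) (chainWeight i₀ i₁ r μ β l)
        (measure_chainConstraint_le hβ hl) _)
      rintro v ⟨hv0, hnd, hlen, A, hA, hb⟩
      -- If the particle of a cluster site entered the block beyond a boundary edge, that block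
      -- would belong to the projection of the cluster.
      refine ⟨A, hA, fun x hx => ⟨fun h0 => h0 ▸ hv0, fun _ e he _ _ hv => ?_⟩, ?_⟩
      · obtain ⟨y, hy, hyx⟩ := exists_mem_frogOut_of_mem_enterSet hv
        refine (hb e he).2.1 ⟨y, ?_, hy⟩
        rw [← Finset.mem_coe, ← hA] at hx
        rw [← hA]
        exact mem_cluster_of_mem_out hx hyx
      · rw [← hlen]
        exact prod_chainWeight_le hβ1 hL hrL hnd hN hv0 hA hb
    · have : bad k l = ∅ := by
        refine Set.eq_empty_of_forall_notMem ?_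
        rintro v ⟨-, -, -, A, -, hb⟩
        exact hl fun e he => (hb e he).2.2
      rw [this, measure_empty]
      exact zero_le
  have hcover : {v : Site d → Frog d N | v 0 = straightFrog N i₀} ⊆
      (⋃ k : ℕ, ⋃ l ∈ edgeChains k (((k : ℤ), 0), ((k : ℤ) + 1, 0)), bad k l) ∪
        {v | (cluster frogOut 0 v).Infinite} := by
    intro v hv0
    by_cases hinf : (cluster frogOut 0 v).Infinite
    · exact Or.inr hinf
    left
    rw [Set.not_infinite] at hinf
    obtain ⟨A, hA⟩ := hinf.exists_finset_coe
    obtain ⟨k, l, hl, hlen, hnd, hb⟩ := exists_edgeChain_boundary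
      (D := block i₀ i₁ r '' (A : Set (Site d))) (A.finite_toSet.image _)
      ⟨0, hA ▸ mem_cluster_self v, by simp [block]⟩ (by
        rintro _ ⟨y, hy, rfl⟩
        refine block_connected i₀ i₁ hr hi ?_
        rw [hA] at hy ⊢
        exact reflTransGen_stepIn_cluster hy)
    exact Set.mem_iUnion.2 ⟨k, Set.mem_biUnion hl ⟨hv0, hnd, hlen, A, hA.symm, hb⟩⟩
  have hsum : P (⋃ k : ℕ, ⋃ l ∈ edgeChains k (((k : ℤ), 0), ((k : ℤ) + 1, 0)), bad k l) ≤
      g * 3⁻¹ := by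
    calc _ ≤ ∑' k : ℕ, P (⋃ l ∈ edgeChains k (((k : ℤ), 0), ((k : ℤ) + 1, 0)), bad k l) :=
          measure_iUnion_le _
      _ ≤ ∑' k : ℕ, g * 4⁻¹ ^ (k + 1) := by
          refine ENNReal.tsum_le_tsum fun k => ?_
          refine (measure_biUnion_finset_le _ _).trans ?_
          refine (Finset.sum_le_card_nsmul _ _ _ fun l _ => hbad k l).trans ?_
          rw [nsmul_eq_mul, mul_left_comm]
          gcongr
          calc ((edgeChains k (((k : ℤ), 0), ((k : ℤ) + 1, 0))).card : ENNReal) * (β ^ L) ^ (k + 1)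
              ≤ 36 ^ (k + 1) * (β ^ L) ^ (k + 1) := by
                gcongr
                have h36 : (edgeChains k (((k : ℤ), 0), ((k : ℤ) + 1, 0))).card ≤ 36 ^ (k + 1) :=
                  (card_edgeChains_le k _).trans (Nat.pow_le_pow_right (by norm_num) (by omega))
                exact_mod_cast h36
            _ = (36 * β ^ L) ^ (k + 1) := (mul_pow _ _ _).symm
            _ ≤ 4⁻¹ ^ (k + 1) := by gcongr
      _ = g * 3⁻¹ := by
          rw [ENNReal.tsum_mul_left, ENNReal.tsum_geometric_add_one]
          congr 1
          rw [← ENNReal.toReal_eq_toReal_iff' (by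
            simp [ENNReal.mul_eq_top, tsub_eq_zero_iff_le, ENNReal.one_le_inv]) (by simp)]
          rw [ENNReal.toReal_mul, ENNReal.toReal_inv, ENNReal.toReal_inv, ENNReal.toReal_sub_of_le
            (by simp) (by simp), ENNReal.toReal_inv, ENNReal.toReal_inv]
          norm_num
  have horigin : P {v : Site d → Frog d N | v 0 = straightFrog N i₀} = g := by
    have h := measurePreserving_eval_infinitePi (fun _ : Site d => μ) 0
    exact h.measure_preimage (MeasurableSet.of_discrete (s := {straightFrog N i₀})).nullMeasurableSet
  by_contra hzero
  rw [not_lt, nonpos_iff_eq_zero] at hzero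
  have h1 : g ≤ g * 3⁻¹ := by
    calc g = _ := horigin.symm
      _ ≤ _ := (measure_mono hcover).trans (measure_union_le _ _)
      _ ≤ g * 3⁻¹ := by rw [hzero, add_zero]; exact hsum
  have h2 : g * 3⁻¹ < g * 1 :=
    (ENNReal.mul_lt_mul_iff_right hpos (measure_ne_top _ _)).2 (by
      rw [ENNReal.inv_lt_one]; norm_num)
  rw [mul_one] at h2
  exact absurd h1 (not_le.2 h2)

end Percolation

/-! ### Choice of the scale and of the threshold. -/

/-- Survival with positive probability, uniformly for survival parameters close to one. -/
theorem exists_survivalProb_pos (ν : Measure ℕ) [IsProbabilityMeasure ν] (hν : 0 < ν {n | 1 ≤ n})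
    (d : ℕ) (hd : 2 ≤ d) :
    ∃ p₀ : unitInterval, p₀ < 1 ∧ ∀ p : unitInterval, p₀ < p → 0 < survivalProb d ν p := by
  have hd0 : 0 < d := by omega
  let i₀ : Fin d := ⟨0, by omega⟩
  let i₁ : Fin d := ⟨1, by omega⟩
  have hi : i₀ ≠ i₁ := by simp [i₀, i₁]
  set δ : ℝ := ν.real {n | 1 ≤ n} with hδ
  have hδpos : 0 < δ := ENNReal.toReal_pos hν.ne' (measure_ne_top _ _)
  have hδ1 : δ ≤ 1 := measureReal_le_one
  -- The factors are the chances that a particle exists, outlives `N` steps and enters the adjacent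
  -- block. As `α` involves no scale, the choices can be made in the order `L`, `N`, `p₀`.
  set α : ℝ := δ * (1 / 2 * hitConst) with hα
  have hc0 := hitConst_pos
  have hc1 := hitConst_le_one
  have hαpos : 0 < α := by positivity
  have hα1 : α ≤ 1 := by nlinarith
  -- The bound `1 / 144` gives `36 * (1 - α) ^ L ≤ 1 / 4`.
  obtain ⟨L, hL⟩ := exists_pow_lt_of_lt_one (by norm_num : (0 : ℝ) < 1 / 144)
    (by linarith : 1 - α < 1)
  have hLpos : 0 < L := by
    rcases Nat.eq_zero_or_pos L with rfl | h
    · norm_num at hL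
    · exact h
  obtain ⟨N₀, hN₀⟩ := exists_hitConst_le_block i₀ i₁ (36 * L) hLpos rfl hi
  set N := max N₀ (3 * (36 * L)) with hN
  have hNpos : (0 : ℝ) < N + 1 := by positivity
  have hinv : 1 / (2 * ((N : ℝ) + 1)) ≤ 1 := by
    rw [div_le_one (by positivity)]
    have : (0 : ℝ) ≤ N := Nat.cast_nonneg N
    linarith
  -- Above this threshold `N * (1 - p) ≤ 1 / 2`, so a lifetime exceeds `N` with probability at least
  -- one half.
  refine ⟨⟨1 - 1 / (2 * ((N : ℝ) + 1)), sub_nonneg.2 hinv, sub_le_self _ (by positivity)⟩,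
    Subtype.coe_lt_coe.1 (sub_lt_self _ (by positivity)), fun p hp => ?_⟩
  have hp' : 1 - 1 / (2 * ((N : ℝ) + 1)) < p := hp
  have hlife : ENNReal.ofReal (1 / 2) ≤ lifetimeLaw p {t | (N : ℕ∞) < t} := by
    refine one_half_le_lifetimeLaw_lt ?_
    have h1 : 1 - (p : ℝ) ≤ 1 / (2 * ((N : ℝ) + 1)) := by linarith
    calc N * (1 - (p : ℝ)) ≤ (N + 1) * (1 / (2 * ((N : ℝ) + 1))) :=
          mul_le_mul (by linarith) h1 (sub_nonneg.2 p.2.2) hNpos.le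
      _ = 1 / 2 := by field_simp
  have hprob := isProbabilityMeasure_frogLaw hd0 N ν p
  have hsteps := isProbabilityMeasure_stepsLaw hd0 N
  have hstep := isProbabilityMeasure_stepLaw hd0
  have hpercolates := infinitePi_infinite_cluster_pos (i₀ := i₀) (i₁ := i₁) (r := 36 * L) (L := L)
    (N := N) (μ := frogLaw d N ν p) (β := ENNReal.ofReal (1 - α))
    (by rw [← ENNReal.ofReal_one]; exact ENNReal.ofReal_le_ofReal (by linarith)) hLpos rfl
    (le_max_right _ _) hi
    (by
      intro e x he hx
      rw [prob_compl_eq_one_sub MeasurableSet.of_discrete, ENNReal.ofReal_sub _ hαpos.le,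
        ENNReal.ofReal_one]
      refine tsub_le_tsub_left ?_ _
      rw [enterSet, frogLaw_good hd0, hα, ENNReal.ofReal_mul hδpos.le,
        ENNReal.ofReal_mul (by norm_num), hδ, ofReal_measureReal]
      gcongr
      rw [ENNReal.ofReal_le_iff_le_toReal (measure_ne_top _ _)]
      exact hN₀ N (le_max_left _ _) e x he hx)
    (by
      rw [← ENNReal.ofReal_pow (by linarith)]
      calc 36 * ENNReal.ofReal ((1 - α) ^ L) ≤ 36 * ENNReal.ofReal (1 / 144) := by gcongr
        _ = 4⁻¹ := by
          rw [← ENNReal.toReal_eq_toReal_iff' (by simp [ENNReal.mul_eq_top]) (by simp),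
            ENNReal.toReal_mul, ENNReal.toReal_ofReal (by norm_num), ENNReal.toReal_inv]
          norm_num)
    (by
      have hset : ({straightFrog N i₀} : Set (Frog d N)) =
          {true} ×ˢ {true} ×ˢ {fun _ => unitStep (i₀, true)} := by
        rw [Set.singleton_prod_singleton, Set.singleton_prod_singleton]; rfl
      rw [hset, frogLaw_good hd0]
      refine mul_ne_zero hν.ne' (mul_ne_zero ?_ ?_)
      · exact ((ENNReal.ofReal_pos.2 (by norm_num)).trans_le hlife).ne'
      · rw [stepsLaw, Measure.pi_singleton]
        refine Finset.prod_ne_zero_iff.2 fun _ _ h0 => ?_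
        have h1 := stepLaw_real_singleton (unitStep_mem (i₀, true))
        rw [Measure.real, h0, ENNReal.toReal_zero] at h1
        have : (0 : ℝ) < (2 * d : ℝ)⁻¹ := by positivity
        linarith)
  rw [← map_frogs_law hd0 N ν p] at hpercolates
  refine hpercolates.trans_le ?_
  rw [Measure.map_apply (measurable_frogs N)]
  · exact measure_mono fun ω hω => survives_of_infinite_cluster hω
  -- There are countably many finite sets, so infinitude of the cluster is measurable. Measurability
  -- of survival itself is not needed, by monotonicity of the outer measure.
  · have hset : {v : Site d → Frog d N | (cluster frogOut 0 v).Infinite} =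
        (⋃ A : Finset (Site d), {v | cluster frogOut 0 v = (A : Set (Site d))})ᶜ := by
      ext v
      simp only [Set.mem_ofPred_eq, Set.mem_compl_iff, Set.mem_iUnion, not_exists]
      constructor
      · intro h A hA
        exact h (hA ▸ A.finite_toSet)
      · intro h hfin
        obtain ⟨A, hA⟩ := hfin.exists_finset_coe
        exact h A hA.symm
    rw [hset]
    exact (MeasurableSet.iUnion fun A => measurableSet_cluster_eq A).compl

end

end FrogModel

theorem theorem2p4 {Ω : Type*} [MeasurableSpace Ω] (P : MeasureTheory.Measure Ω)
    [MeasureTheory.IsProbabilityMeasure P] (η : Ω → ℕ) (hη : Measurable η)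
    (hpos : 0 < P {ω | 1 ≤ η ω}) (d : ℕ) (hd : 2 ≤ d) :
    FrogModel.criticalParam d (P.map η) < 1 ∧
      ∃ p₀ : unitInterval, p₀ < 1 ∧
        ∀ p : unitInterval, p₀ < p → 0 < FrogModel.survivalProb d (P.map η) p := by
  have hprob : MeasureTheory.IsProbabilityMeasure (P.map η) :=
    MeasureTheory.Measure.isProbabilityMeasure_map hη.aemeasurable
  have hν : 0 < (P.map η) {n | 1 ≤ n} := by
    rw [MeasureTheory.Measure.map_apply hη MeasurableSet.of_discrete]
    exact hpos
  obtain ⟨p₀, hp₀, h⟩ := FrogModel.exists_survivalProb_pos (P.map η) hν d hd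
  refine ⟨?_, p₀, hp₀, h⟩
  obtain ⟨p, hp, hp1⟩ := exists_between hp₀
  have hle : FrogModel.criticalParam d (P.map η) ≤ p := sInf_le (h p hp)
  exact hle.trans_lt hp1
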